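/- Assume $\diamondsuit^+$: there is a sequence $(W_\alpha)_{\alpha<\omega_1}$ of countable sets such that for every $X\subseteq\omega_1$ there is a closed unbounded set $D\subseteq\omega_1$ with $X\cap\alpha\in W_\alpha$ and $D\cap\alpha\in W_\alpha$ for all $\alpha\in D$. A tree is a partially ordered set in which the set of strict predecessors of each element $t$ is well ordered; the order type of this set is the height of $t$. An $\aleph_1$-tree is a tree of height $\omega_1$ all of whose levels are countable. An Aronszajn tree is an $\aleph_1$-tree with no uncountable chains, and a Suslin tree is an $\aleph_1$-tree with no uncountable chains and no uncountable antichains. The set $2^{<\omega_1}$ of all functions $\alpha\to 2$ with $\alpha<\omega_1$ is ordered by end extension. Let $\mathbf C=(C_\alpha)_{\alpha\in\lim\omega_1}$ be a ladder system, that is, for every countable limit ordinal $\alpha>0$ let $C_\alpha$ be a cofinal subset of $\alpha$ of order type $\omega$. Then there is a downward closed set $T\subseteq 2^{<\omega_1}$ which is an Aronszajn tree and has the following property. For every sequence $\mathbf f=(f_\alpha)_{\alpha\in\lim\omega_1}$ of constant maps $f_\alpha\colon C_\alpha\to\omega$ there are a subset $S\subseteq T$ and a map $\varphi\colon S\to\omega$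 such that 1. $S$ is a subtree of $T$: it is non-empty and downward closed in $T$, and every $s\in S$ has extensions in $S$ of arbitrarily large height below $\omega_1$; 2. $S$, with the induced order, is a Suslin tree; 3. for every $s\in S$ of limit height $\alpha$ and for all but finitely many $\xi\in C_\alpha$, $\varphi(s\upharpoonright\xi)=f_\alpha(\xi)$, where $s\upharpoonright\xi$ is the predecessor of $s$ of height $\xi$. -/

import Mathlib

open scoped Ordinal

namespace TreeUnif

/-- The ordinal `ω₁`, as the set of all countable ordinals. -/
abbrev Omega1 : Type 1 := Set.Iio (ω_ 1 : Ordinal.{0})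

/-- `◇⁺`: there are countable families `W α` (`α < ω₁`) such that for every `X ⊆ ω₁` there is
a closed unbounded `D ⊆ ω₁` with `X ∩ α, D ∩ α ∈ W α` for all `α ∈ D`. -/
def DiamondPlus : Prop :=
  ∃ W : Omega1 → Set (Set Omega1),
    (∀ α, (W α).Countable) ∧
      ∀ X : Set Omega1, ∃ D : Set Omega1, IsClub D ∧
        ∀ α ∈ D, X ∩ Set.Iio α ∈ W α ∧ D ∩ Set.Iio α ∈ W α

/-- A ladder system on `ω₁`: for every limit `α < ω₁` (so `α ≠ 0`), `C α` is a cofinal subset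
of `α` of order type `ω`. The values of `C` at other ordinals are irrelevant. -/
def IsLadderSystem (C : Omega1 → Set Omega1) : Prop :=
  ∀ α : Omega1, Order.IsSuccLimit α →
    C α ⊆ Set.Iio α ∧ (∀ β < α, ∃ ξ ∈ C α, β ≤ ξ) ∧ Nonempty (C α ≃o ℕ)

/-- An `ω`-colouring of `C`: a sequence of maps `f α : C α → ω`. -/
abbrev Colouring (C : Omega1 → Set Omega1) : Type 1 := (α : Omega1) → C α → ℕ

/-- The colouring `f` is monochromatic if each `f α`, `α` a countable limit ordinal,
is constant. -/
def IsMonochromatic {C : Omega1 → Set Omega1} (f : Colouring C) : Prop :=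
  ∀ α : Omega1, Order.IsSuccLimit α → ∃ n : ℕ, ∀ ξ : C α, f α ξ = n

section Trees

/-- A tree: a partially ordered set in which the set of strict predecessors of every element
is well ordered. -/
def IsTree (T : Type*) [PartialOrder T] : Prop :=
  ∀ t : T, IsWellOrder (Set.Iio t) (· < ·)

/-- The node `t` has height `α`: the order type of its set of strict predecessors is `α`. -/
def HasHeight {T : Type*} [PartialOrder T] (t : T) (α : Omega1) : Prop :=
  Nonempty (Set.Iio t ≃o Set.Iio α)

/-- An `ℵ₁`-tree: a tree of height `ω₁` (all heights of nodes are below `ω₁`, and all levels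
below `ω₁` are non-empty) with countable levels. -/
structure IsAleph1Tree (T : Type*) [PartialOrder T] : Prop where
  isTree : IsTree T
  height_lt : ∀ t : T, ∃ α : Omega1, HasHeight t α
  level_nonempty : ∀ α : Omega1, {t : T | HasHeight t α}.Nonempty
  level_countable : ∀ α : Omega1, {t : T | HasHeight t α}.Countable

/-- An Aronszajn tree: an `ℵ₁`-tree without uncountable chains. -/
structure IsAronszajnTree (T : Type*) [PartialOrder T] : Prop extends IsAleph1Tree T where
  chain_countable : ∀ A : Set T, IsChain (· ≤ ·) A → A.Countable

/-- A Suslin tree: an `ℵ₁`-tree without uncountable chains or uncountable antichains. -/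
structure IsSuslinTree (T : Type*) [PartialOrder T] : Prop extends IsAronszajnTree T where
  antichain_countable : ∀ A : Set T, IsAntichain (· ≤ ·) A → A.Countable

/-- A subtree of a tree `T` of height `ω₁`: a non-empty, downward closed subset `S` such that
every `s ∈ S` has extensions in `S` of arbitrarily large height below `ω₁`. -/
structure IsSubtree {T : Type*} [PartialOrder T] (S : Set T) : Prop where
  nonempty : S.Nonempty
  isLowerSet : IsLowerSet S
  pruned : ∀ s ∈ S, ∀ α : Omega1, ∃ t ∈ S, s ≤ t ∧ ∃ β : Omega1, α ≤ β ∧ HasHeight t β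

/-- The map `φ` on the subtree `S` of `T` uniformizes the colouring `f` of `C`: for every
`s ∈ S` of limit height `α` and all but finitely many `ξ ∈ C α`, `φ (s ↾ ξ) = f α ξ`. Here
`s ↾ ξ` is the predecessor `r` of `s` of height `ξ`. -/
def Uniformizes {T : Type*} [PartialOrder T] {S : Set T} (φ : S → ℕ)
    {C : Omega1 → Set Omega1} (f : Colouring C) : Prop :=
  ∀ (s : S) (α : Omega1), Order.IsSuccLimit α → HasHeight (s : T) α →
    ∀ᶠ ξ : C α in Filter.cofinite,
      ∃ r : S, r < s ∧ HasHeight (r : T) (ξ : Omega1) ∧ φ r = f α ξ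

end Trees

/-- The elements of `2^{<ω₁}`: functions from a countable ordinal to `2`. -/
structure BinSeq : Type 1 where
  len : Omega1
  val : Set.Iio len → Bool

/-- `2^{<ω₁}` is ordered by end extension. -/
instance : PartialOrder BinSeq where
  le s t := ∃ h : s.len ≤ t.len, ∀ ξ : Set.Iio s.len,
    s.val ξ = t.val ⟨ξ.1, lt_of_lt_of_le ξ.2 h⟩
  le_refl s := ⟨le_rfl, fun _ => rfl⟩
  le_trans := by
    rintro s t u ⟨h₁, e₁⟩ ⟨h₂, e₂⟩
    exact ⟨h₁.trans h₂, fun ξ => (e₁ ξ).trans (e₂ _)⟩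
  le_antisymm := by
    rintro ⟨a, s⟩ ⟨b, t⟩ ⟨h₁, e₁⟩ ⟨h₂, e₂⟩
    obtain rfl : a = b := le_antisymm h₁ h₂
    congr 1
    funext ξ
    exact e₁ ξ

end TreeUnif

namespace TreeUnif

open Set Order

/-! ### The ordinal `ω₁` -/

/-! A colouring by constant maps amounts to a function `g : ω₁ → ω`, and ◇⁺ gives a club `E` of
limit ordinals such that at each `δ ∈ E` one of countably many guesses is right about `g` and `E`
below `δ`. The nodes of limit length in `T` carry a tag: a guess of `g` and `E`, and a label `(m,
n)`. The subtree `S` for `g` consists of the nodes whose tags are right at all accumulation points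
of `E`.

The colour of a node is read off from the tags. Let `p < e` be consecutive points of `E` and let
`(m, n)` be the label at `p`. A node of height `ξ ∈ [p, e)` gets colour `n` if `ξ` has index at most
`m` in an enumeration of `e`; otherwise it gets `g α`, where `α ≤ e` is the ladder to which `ξ` is
assigned once the ladders up to `e` are made disjoint modulo finite sets. A label affects only
finitely many heights, so limits that do not accumulate `E` are uniformized for free
(`finite_colour_ne`).

At an accumulation point `δ` of `E`, each gap below `δ` contains only finitely many points of the
ladder, so labels can force the single colour `g δ` on almost all of it.
`not_countable_branches_subtree` finds uncountably many branches that do so and also pass through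
the set proposed by a ◇-sequence, if that set is dense. Level `δ` faces countably many demands, and
`exists_step` meets them by distinct branches, so that each node answers to one guess only. Finite
colour conditions are part of the demands, since a climb towards `δ` may have to cross smaller
accumulation points with prescribed colours (`exists_extension`).

Branches with characteristic function in the ◇⁺ family are avoided, which excludes uncountable
chains; passing through the guessed dense sets excludes uncountable antichains of `S`. -/

theorem countable_Iio_omega1 (a : Omega1) : (Iio a).Countable := by
  have h : (Iio a.1).Countable := by
    rw [← Cardinal.le_aleph0_iff_set_countable, Cardinal.mk_Iio_ordinal]
    have := Cardinal.lt_omega_iff_card_lt.1 a.2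
    rw [← Cardinal.succ_aleph0, Order.lt_succ_iff] at this
    exact Cardinal.lift_le_aleph0.2 this
  exact (h.preimage Subtype.val_injective).mono fun x hx => hx

theorem countable_Iic_omega1 (a : Omega1) : (Iic a).Countable := by
  rw [← Iio_insert]
  exact (countable_Iio_omega1 a).insert a

instance : Uncountable Omega1 := by
  rw [← Cardinal.aleph0_lt_mk_iff]
  change Cardinal.aleph0 < Cardinal.mk (Iio (ω_ 1 : Ordinal.{0}))
  rw [Cardinal.mk_Iio_ordinal, Ordinal.card_omega, ← Cardinal.lift_aleph0.{1, 0},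
    Cardinal.lift_lt]
  exact Cardinal.aleph0_lt_aleph_one

theorem exists_gt_of_countable {s : Set Omega1} (hs : s.Countable) : ∃ a, ∀ x ∈ s, x < a := by
  by_contra! h
  refine not_countable_univ (α := Omega1) ((hs.biUnion fun x _ => countable_Iic_omega1 x).mono ?_)
  intro a _
  obtain ⟨x, hx, hax⟩ := h a
  exact mem_biUnion hx hax

instance : NoMaxOrder Omega1 where
  exists_gt a := by
    obtain ⟨b, hb⟩ := exists_gt_of_countable (countable_singleton a)
    exact ⟨b, hb a rfl⟩

/-- The form of uncountable cofinality needed for intersecting clubs. -/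
theorem cof_omega1_ne : Order.cof Omega1 ≠ Cardinal.aleph0 := by
  intro h
  obtain ⟨s, hs, hc⟩ := exists_cof_eq Omega1
  have hs' : s.Countable := by
    rw [← Cardinal.le_aleph0_iff_set_countable, hc, h]
  obtain ⟨a, ha⟩ := exists_gt_of_countable hs'
  obtain ⟨b, hb, hab⟩ := hs a
  exact (ha b hb).not_ge hab

/-- The least ordinal satisfying `p`, if there is one. -/
noncomputable def least (p : Omega1 → Prop) : Omega1 :=
  open Classical in
  if h : ∃ x, p x then wellFounded_lt.min {x | p x} h else Classical.arbitrary _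

theorem least_spec {p : Omega1 → Prop} (h : ∃ x, p x) : p (least p) := by
  rw [least, dif_pos h]
  exact wellFounded_lt.min_mem {x | p x} h

theorem least_le {p : Omega1 → Prop} {a : Omega1} (h : p a) : least p ≤ a := by
  rw [least, dif_pos ⟨a, h⟩]
  exact wellFounded_lt.min_le (s := {x | p x}) h

theorem exists_gt_fun (p : Omega1 → Omega1) (a : Omega1) : ∃ b, a < b ∧ ∀ x ≤ a, p x < b := by
  obtain ⟨b, hb⟩ := exists_gt_of_countable (((countable_Iic_omega1 a).image p).insert a)
  exact ⟨b, hb _ (mem_insert _ _), fun x hx => hb _ (mem_insert_of_mem _ ⟨x, hx, rfl⟩)⟩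

theorem exists_isLUB_of_countable {s : Set Omega1} (hs : s.Countable) : ∃ a, IsLUB s a := by
  obtain ⟨b, hb⟩ := exists_gt_of_countable hs
  exact ⟨least (· ∈ upperBounds s), least_spec (p := (· ∈ upperBounds s)) ⟨b, fun x hx => (hb x hx).le⟩,
    fun c hc => least_le hc⟩

theorem isClub_closed_fun (p : Omega1 → Omega1) :
    IsClub {a : Omega1 | IsSuccLimit a ∧ ∀ x < a, p x < a} := by
  refine ⟨?_, ?_⟩
  · intro s hs hne _ a ha
    have key : ∀ x < a, ∃ y ∈ s, x < y := fun x hx => by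
      by_contra! h
      exact (ha.2 h).not_gt hx
    refine ⟨⟨?_, ?_⟩, ?_⟩
    · obtain ⟨y, hy⟩ := hne
      intro hmin
      exact (hs hy).1.1 (fun z hz => (hmin ((hz.trans (ha.1 hy)))).trans' (ha.1 hy))
    · intro x hx
      obtain ⟨y, hy, hxy⟩ := key x hx.1
      obtain ⟨z, hz⟩ := (hs hy).1.2 |> fun h => (not_covBy_iff hxy).1 (h x)
      exact hx.2 hz.1 (hz.2.trans_le (ha.1 hy))
    · intro x hx
      obtain ⟨y, hy, hxy⟩ := key x hx
      exact ((hs hy).2 x hxy).trans_le (ha.1 hy)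
  · intro a
    choose q hq hq' using exists_gt_fun p
    have hmono : StrictMono fun n => q^[n] a := by
      refine strictMono_nat_of_lt_succ fun n => ?_
      rw [Function.iterate_succ_apply']
      exact hq _
    obtain ⟨b, hb⟩ := exists_isLUB_of_countable (countable_range fun n => q^[n] a)
    have key : ∀ x < b, ∃ n, x < q^[n] a := fun x hx => by
      by_contra! h
      refine (hb.2 ?_).not_gt hx
      rintro _ ⟨n, rfl⟩
      exact h n
    have hlt : ∀ n, q^[n] a < b := fun n =>
      (hmono n.lt_succ_self).trans_le (hb.1 ⟨n + 1, rfl⟩)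
    refine ⟨b, ⟨⟨?_, ?_⟩, ?_⟩, (hlt 0).le⟩
    · intro h
      exact (hlt 0).not_ge (h (hlt 0).le)
    · intro x hx
      obtain ⟨n, hn⟩ := key x hx.1
      exact hx.2 hn (hlt n)
    · intro x hx
      obtain ⟨n, hn⟩ := key x hx
      refine (hq' _ x hn.le).trans ?_
      have := hlt (n + 1)
      rwa [Function.iterate_succ_apply'] at this

/-- Recursion for constructions whose steps are subject to a condition on the earlier values. -/
theorem exists_wf_recursion {α V : Type*} [Preorder α] [WellFoundedLT α] [Nonempty V]
    (P : α → (α → V) → V → Prop) (hex : ∀ a f, ∃ v, P a f v)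
    (hloc : ∀ a f f' v, (∀ x < a, f x = f' x) → P a f v → P a f' v) :
    ∃ F : α → V, ∀ a, P a F (F a) := by
  classical
  choose c hc using hex
  let F : α → V := (wellFounded_lt (α := α)).fix fun a ih =>
    c a fun x => if h : x < a then ih x h else Classical.arbitrary V
  have hF : ∀ a, F a = c a fun x => if x < a then F x else Classical.arbitrary V := fun a => by
    have := (wellFounded_lt (α := α)).fix_eq (C := fun _ => V) (fun a ih =>
      c a fun x => if h : x < a then ih x h else Classical.arbitrary V) a
    simpa using this
  refine ⟨F, fun a => ?_⟩
  rw [hF a]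
  refine hloc a _ F _ (fun x hx => ?_) (hc a _)
  simp [hx]

/-- Uncountable sets with countably many indices have an injective choice function avoiding a
given countable set. -/
theorem exists_injective_choice {ι X : Type*} [Countable ι] (B : ι → Set X)
    (hB : ∀ i, ¬ (B i).Countable) {V : Set X} (hV : V.Countable) :
    ∃ f : ι → X, Function.Injective f ∧ ∀ i, f i ∈ B i ∧ f i ∉ V := by
  rcases isEmpty_or_nonempty ι with hι | ⟨⟨i₀⟩⟩
  · exact ⟨isEmptyElim, fun i => isEmptyElim i, fun i => isEmptyElim i⟩
  have hX : Nonempty X := by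
    by_contra h
    rw [not_nonempty_iff] at h
    exact hB i₀ (Set.to_countable _)
  obtain ⟨e, he⟩ := exists_injective_nat ι
  let P : ℕ → (ℕ → X) → X → Prop := fun n f v =>
    ∀ i, e i = n → v ∈ B i ∧ v ∉ V ∧ ∀ m < n, v ≠ f m
  obtain ⟨F, hF⟩ := exists_wf_recursion P (fun n f => by
    by_cases h : ∃ i, e i = n
    · obtain ⟨i, hi⟩ := h
      have : ¬ B i ⊆ V ∪ f '' Iio n := fun hs =>
        hB i ((hV.union ((to_countable (Iio n)).image f)).mono hs)
      obtain ⟨v, hv, hv'⟩ := not_subset.1 this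
      rw [mem_union, not_or] at hv'
      refine ⟨v, fun j hj => ?_⟩
      obtain rfl : i = j := he (hi.trans hj.symm)
      exact ⟨hv, hv'.1, fun m hm h => hv'.2 ⟨m, hm, h.symm⟩⟩
    · exact ⟨Classical.arbitrary X, fun i hi => (h ⟨i, hi⟩).elim⟩)
    (fun n f f' v h hP i hi => ⟨(hP i hi).1, (hP i hi).2.1, fun m hm => by
      rw [← h m hm]; exact (hP i hi).2.2 m hm⟩)
  refine ⟨fun i => F (e i), fun i j hij => ?_, fun i => ⟨(hF _ i rfl).1, (hF _ i rfl).2.1⟩⟩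
  by_contra hne
  rcases lt_or_gt_of_ne (fun h => hne (he h)) with h | h
  · exact (hF _ j rfl).2.2 _ h hij.symm
  · exact (hF _ i rfl).2.2 _ h hij

/-! ### Binary sequences -/

namespace BinSeq

/-- The extension of a binary sequence to all of `ω₁` by `false`. -/
noncomputable def ext (b : BinSeq) (ξ : Omega1) : Bool :=
  open Classical in if h : ξ < b.len then b.val ⟨ξ, h⟩ else false

/-- The sequence of length `α` with values given by `x`. -/
def ofFun (α : Omega1) (x : Omega1 → Bool) : BinSeq := ⟨α, fun ξ => x ξ⟩

@[simp] theorem len_ofFun (α : Omega1) (x : Omega1 → Bool) : (ofFun α x).len = α := rfl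

theorem ext_ofFun {α ξ : Omega1} (x : Omega1 → Bool) (h : ξ < α) : (ofFun α x).ext ξ = x ξ := by
  rw [ext, dif_pos (show ξ < (ofFun α x).len from h)]
  rfl

theorem le_iff {s t : BinSeq} : s ≤ t ↔ s.len ≤ t.len ∧ ∀ ξ < s.len, s.ext ξ = t.ext ξ := by
  constructor
  · rintro ⟨h, e⟩
    refine ⟨h, fun ξ hξ => ?_⟩
    rw [ext, ext, dif_pos hξ, dif_pos (hξ.trans_le h)]
    exact e ⟨ξ, hξ⟩
  · rintro ⟨h, e⟩
    refine ⟨h, fun ξ => ?_⟩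
    have := e ξ.1 ξ.2
    rw [ext, ext, dif_pos (mem_Iio.1 ξ.2), dif_pos (lt_of_lt_of_le (mem_Iio.1 ξ.2) h)] at this
    exact this

theorem len_mono {s t : BinSeq} (h : s ≤ t) : s.len ≤ t.len := h.1

theorem eq_of_le_of_len_le {s t : BinSeq} (h : s ≤ t) (h' : t.len ≤ s.len) : s = t := by
  refine le_antisymm h (le_iff.2 ⟨h', fun ξ hξ => ((le_iff.1 h).2 ξ ?_).symm⟩)
  exact hξ.trans_le h'

theorem len_lt_of_lt {s t : BinSeq} (h : s < t) : s.len < t.len :=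
  lt_of_not_ge fun h' => h.ne (eq_of_le_of_len_le h.le h')

/-- The restriction of a binary sequence to `ξ` (to its length if `ξ` is bigger). -/
noncomputable def res (b : BinSeq) (ξ : Omega1) : BinSeq := ofFun (min ξ b.len) b.ext

theorem len_res {b : BinSeq} {ξ : Omega1} (h : ξ ≤ b.len) : (b.res ξ).len = ξ := min_eq_left h

theorem res_le (b : BinSeq) (ξ : Omega1) : b.res ξ ≤ b :=
  le_iff.2 ⟨min_le_right _ _, fun _ hη => ext_ofFun _ hη⟩

theorem eq_of_le_of_le {s t b : BinSeq} (hs : s ≤ b) (ht : t ≤ b) (h : s.len = t.len) : s = t := by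
  refine eq_of_le_of_len_le (le_iff.2 ⟨h.le, fun ξ hξ => ?_⟩) h.ge
  rw [(le_iff.1 hs).2 ξ hξ, (le_iff.1 ht).2 ξ (h ▸ hξ)]

theorem res_eq {s b : BinSeq} (h : s ≤ b) {ξ : Omega1} (hξ : ξ = s.len) : b.res ξ = s :=
  eq_of_le_of_le (res_le _ _) h (by rw [len_res (hξ.le.trans h.1), hξ])

theorem res_len (b : BinSeq) : b.res b.len = b := res_eq le_rfl rfl

theorem res_of_le {s b : BinSeq} (h : s ≤ b) {ξ : Omega1} (hξ : ξ ≤ s.len) : b.res ξ = s.res ξ :=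
  res_eq ((res_le s ξ).trans h) (len_res hξ).symm

theorem res_res {b : BinSeq} {ξ η : Omega1} (h : ξ ≤ η) (hη : η ≤ b.len) :
    (b.res η).res ξ = b.res ξ :=
  (res_of_le (res_le b η) (by rwa [len_res hη])).symm

theorem le_res {s b : BinSeq} (h : s ≤ b) {ξ : Omega1} (hξ : s.len ≤ ξ) (hb : ξ ≤ b.len) :
    s ≤ b.res ξ :=
  le_iff.2 ⟨by rwa [len_res hb], fun η hη => by
    rw [(le_iff.1 h).2 η hη, (le_iff.1 (res_le b ξ)).2 η (by rw [len_res hb]; exact hη.trans_le hξ)]⟩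

theorem le_of_len_le {s t b : BinSeq} (hs : s ≤ b) (ht : t ≤ b) (h : s.len ≤ t.len) : s ≤ t := by
  rw [← res_eq ht rfl]
  exact le_res hs h ht.1

theorem ext_injOn {s t : BinSeq} (h : s.len = t.len) (h' : ∀ ξ < s.len, s.ext ξ = t.ext ξ) :
    s = t :=
  eq_of_le_of_len_le (le_iff.2 ⟨h.le, h'⟩) h.ge

/-- The subset of `len b` whose characteristic function is `b`. -/
def support (b : BinSeq) : Set Omega1 := {ξ | ξ < b.len ∧ b.ext ξ = true}

theorem eq_of_support_eq {s t : BinSeq} (h : s.len = t.len) (h' : s.support = t.support) :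
    s = t := by
  refine ext_injOn h fun ξ hξ => ?_
  have : ξ ∈ s.support ↔ ξ ∈ t.support := by rw [h']
  simp only [support, mem_ofPred_eq, hξ, h ▸ hξ, true_and] at this
  exact Bool.eq_iff_iff.2 this

/-- The sequence `b` followed by the bit `i`. -/
noncomputable def snoc (b : BinSeq) (i : Bool) : BinSeq :=
  open Classical in ofFun (succ b.len) fun ξ => if ξ < b.len then b.ext ξ else i

@[simp] theorem len_snoc (b : BinSeq) (i : Bool) : (b.snoc i).len = succ b.len := rfl

theorem le_snoc (b : BinSeq) (i : Bool) : b ≤ b.snoc i :=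
  le_iff.2 ⟨le_succ _, fun ξ hξ => by
    rw [snoc, ext_ofFun _ (hξ.trans_le (le_succ _)), if_pos hξ]⟩

theorem ext_snoc_len (b : BinSeq) (i : Bool) : (b.snoc i).ext b.len = i := by
  rw [snoc, ext_ofFun _ (lt_succ _), if_neg (lt_irrefl _)]

theorem snoc_injective (b : BinSeq) : Function.Injective b.snoc := fun i j h => by
  rw [← ext_snoc_len b i, h, ext_snoc_len]

theorem eq_snoc_of_len {b : BinSeq} {α : Omega1} (h : b.len = succ α) :
    b = (b.res α).snoc (b.ext α) := by
  have hα : (b.res α).len = α := len_res (h ▸ le_succ α)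
  refine ext_injOn (by rw [len_snoc, hα, h]) fun ξ hξ => ?_
  rcases (lt_succ_iff.1 (h ▸ hξ)).eq_or_lt with rfl | hlt
  · have := ext_snoc_len (b.res ξ) (b.ext ξ)
    rw [hα] at this
    exact this.symm
  · rw [← (le_iff.1 (le_snoc (b.res α) (b.ext α))).2 ξ (by rwa [hα]),
      (le_iff.1 (res_le b α)).2 ξ (by rwa [hα])]

theorem exists_empty : ∃ b : BinSeq, IsMin b.len :=
  ⟨ofFun (least fun _ => True) fun _ => false, fun _ _ => least_le trivial⟩

end BinSeq

/-- Nodes of length below `δ` that can be extended cofinally in incompatible ways have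
uncountably many limits of length `δ`. -/
theorem not_countable_branches {δ : Omega1} (hδ : IsSuccLimit δ) {Z : Set BinSeq}
    (hlen : ∀ z ∈ Z, z.len < δ)
    (hZ : ∀ z ∈ Z, ∀ β < δ, ∀ b : BinSeq, ∃ z' ∈ Z, z ≤ z' ∧ β ≤ z'.len ∧ ¬ z' ≤ b)
    {z₀ : BinSeq} (hz₀ : z₀ ∈ Z) :
    ¬ {b : BinSeq | b.len = δ ∧ z₀ ≤ b ∧ ∀ β < δ, ∃ z ∈ Z, β < z.len ∧ z ≤ b}.Countable := by
  intro hc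
  have : Nonempty BinSeq := ⟨z₀⟩
  obtain ⟨v, hv⟩ := countable_iff_exists_subset_range.1 hc
  obtain ⟨a, ha⟩ := (countable_Iio_omega1 δ).exists_eq_range ⟨z₀.len, hlen _ hz₀⟩
  have haδ : ∀ n, a n < δ := fun n => by
    have : a n ∈ Iio δ := ha ▸ mem_range_self n
    exact this
  -- Diagonalization: stage `n` climbs above `a n` and leaves `v n`, so the limit is a branch that
  -- the enumeration `v` misses.
  have step : ∀ (n : ℕ) (z : Z), ∃ z' : Z, z.1 ≤ z'.1 ∧ a n ≤ z'.1.len ∧ ¬ z'.1 ≤ v n := by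
    rintro n ⟨z, hz⟩
    obtain ⟨z', h, h'⟩ := hZ z hz (a n) (haδ n) (v n)
    exact ⟨⟨z', h⟩, h'⟩
  choose nxt hnxt using step
  let z : ℕ → Z := fun n => Nat.rec ⟨z₀, hz₀⟩ nxt n
  have hmono : Monotone fun n => (z n).1 := monotone_nat_of_le_succ fun n => (hnxt n (z n)).1
  have hcof : ∀ β < δ, ∃ n, β < (z n).1.len := fun β hβ => by
    obtain ⟨γ, hβγ, hγ⟩ := (not_covBy_iff hβ).1 (hδ.2 β)
    have : γ ∈ range a := ha ▸ hγ
    obtain ⟨n, rfl⟩ := this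
    exact ⟨n + 1, hβγ.trans_le (hnxt n (z n)).2.1⟩
  choose! N hN using hcof
  let b := BinSeq.ofFun δ fun ξ => (z (N ξ)).1.ext ξ
  have hb : ∀ n, (z n).1 ≤ b := fun n => by
    refine BinSeq.le_iff.2 ⟨(hlen _ (z n).2).le, fun ξ hξ => ?_⟩
    have hξδ := hξ.trans (hlen _ (z n).2)
    rw [BinSeq.ext_ofFun _ hξδ]
    rcases le_total n (N ξ) with h | h
    · exact (BinSeq.le_iff.1 (hmono h)).2 ξ hξ
    · exact ((BinSeq.le_iff.1 (hmono h)).2 ξ (hN ξ hξδ)).symm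
  obtain ⟨n, hn⟩ := hv ⟨rfl, hb 0, fun β hβ => ⟨_, (z (N β)).2, hN β hβ, hb _⟩⟩
  exact (hnxt n (z n)).2.2 (hn ▸ hb (n + 1))

/-! ### Labelled trees, their subtrees and colourings -/

/-- The label of a node of limit length: a guess for a colouring and a club, and a code for the
colouring of the nodes that follow. -/
abbrev Tag : Type 1 := (Omega1 → ℕ) × Set Omega1 × (ℕ × ℕ)

/-- The tree of all sequences whose restrictions to limit ordinals are labelled. -/
def tree (R : BinSeq → Option Tag) : Set BinSeq :=
  {b | ∀ δ ≤ b.len, IsSuccLimit δ → R (b.res δ) ≠ none}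

/-- `δ` is a limit of elements of `E`. -/
def Acc (E : Set Omega1) (δ : Omega1) : Prop :=
  IsSuccLimit δ ∧ ∀ β < δ, ∃ ξ ∈ E, β < ξ ∧ ξ < δ

/-- The tag `t` guesses `g` on `δ + 1` and `E` on `δ`. -/
def Matches (δ : Omega1) (g : Omega1 → ℕ) (E : Set Omega1) (t : Tag) : Prop :=
  (∀ ξ ≤ δ, t.1 ξ = g ξ) ∧ ∀ ξ < δ, ξ ∈ t.2.1 ↔ ξ ∈ E

/-- The subtree of all nodes whose tags at limits of `E` are right about `g` and `E`. -/
def subtree (R : BinSeq → Option Tag) (g : Omega1 → ℕ) (E : Set Omega1) : Set BinSeq :=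
  {b | b ∈ tree R ∧ ∀ δ ≤ b.len, Acc E δ → ∃ t, R (b.res δ) = some t ∧ Matches δ g E t}

/-- The code given by the tag of `b`. -/
def label (R : BinSeq → Option Tag) (b : BinSeq) : ℕ × ℕ :=
  ((R b).map fun t => t.2.2).getD (0, 0)

/-- The supremum of the elements of `E` up to `ξ`. -/
noncomputable def floor (E : Set Omega1) (ξ : Omega1) : Omega1 :=
  least fun e => ∀ x ∈ E, x ≤ ξ → x ≤ e

/-- The least element of `E` above `ξ`. -/
noncomputable def next (E : Set Omega1) (ξ : Omega1) : Omega1 :=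
  least fun e => e ∈ E ∧ ξ < e

/-- The combinatorial data from which the tree is built. -/
structure Context (C : Omega1 → Set Omega1) where
  /-- The sets whose characteristic functions are kept out of the tree. -/
  killed : Omega1 → Set (Set Omega1)
  killed_countable : ∀ δ, (killed δ).Countable
  /-- The guesses for a colouring and a club. -/
  guess : Omega1 → Set ((Omega1 → ℕ) × Set Omega1)
  guess_countable : ∀ δ, (guess δ).Countable
  /-- The guess for a dense set of nodes. -/
  diamond : Omega1 → Set BinSeq
  /-- Enumerations of the countable ordinals. -/
  idx : Omega1 → Omega1 → ℕ
  idx_injOn : ∀ β, InjOn (idx β) (Iio β)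
  /-- A disjointification of the ladders up to `β`. -/
  pick : Omega1 → Omega1 → Omega1
  pick_le : ∀ β ξ, pick β ξ ≤ β
  finite_pick_ne : ∀ β α, IsSuccLimit α → α ≤ β → {ξ ∈ C α | pick β ξ ≠ α}.Finite
  ladder_lt : ∀ α, IsSuccLimit α → ∀ ξ ∈ C α, ξ < α
  ladder_finite : ∀ α, IsSuccLimit α → ∀ β < α, {ξ ∈ C α | ξ ≤ β}.Finite

theorem tree_isLowerSet (R : BinSeq → Option Tag) : IsLowerSet (tree R) := by
  intro b s hs hb δ hδ hlim
  rw [← BinSeq.res_of_le hs hδ]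
  exact hb δ (hδ.trans hs.1) hlim

theorem subtree_subset (R : BinSeq → Option Tag) (g : Omega1 → ℕ) (E : Set Omega1) :
    subtree R g E ⊆ tree R := fun _ h => h.1

theorem subtree_isLowerSet (R : BinSeq → Option Tag) (g : Omega1 → ℕ) (E : Set Omega1) :
    IsLowerSet (subtree R g E) := by
  intro b s hs hb
  refine ⟨tree_isLowerSet R hs hb.1, fun δ hδ hacc => ?_⟩
  rw [← BinSeq.res_of_le hs hδ]
  exact hb.2 δ (hδ.trans hs.1) hacc

/-- Tags are tested only at accumulation points of `E`, so any extension in the whole tree may be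
used to cross a stretch without them. -/
theorem mem_subtree_of_not_acc {R : BinSeq → Option Tag} {g : Omega1 → ℕ} {E : Set Omega1}
    {s t : BinSeq} (hs : s ∈ subtree R g E) (hst : s ≤ t) (ht : t ∈ tree R)
    (h : ∀ δ, s.len < δ → δ ≤ t.len → ¬ Acc E δ) : t ∈ subtree R g E := by
  refine ⟨ht, fun δ hδ hacc => ?_⟩
  have hle : δ ≤ s.len := le_of_not_gt fun h' => h δ h' hδ hacc
  rw [BinSeq.res_of_le hst hle]
  exact hs.2 δ hle hacc

theorem snoc_mem_tree {R : BinSeq → Option Tag} {b : BinSeq} (hb : b ∈ tree R) (i : Bool) :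
    b.snoc i ∈ tree R := by
  intro δ hδ hlim
  have : δ ≤ b.len := by
    rcases hδ.eq_or_lt with rfl | h
    · exact absurd hlim.2 (not_isSuccPrelimit_succ _)
    · exact lt_succ_iff.1 h
  rw [BinSeq.res_of_le (b.le_snoc i) this]
  exact hb δ this hlim

theorem empty_mem_subtree (R : BinSeq → Option Tag) (g : Omega1 → ℕ) (E : Set Omega1)
    {b : BinSeq} (hb : IsMin b.len) : b ∈ subtree R g E := by
  have h : ∀ δ ≤ b.len, ¬ IsSuccLimit δ := fun δ hδ hlim => hlim.1 (hb.mono hδ)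
  exact ⟨fun δ hδ hlim => (h δ hδ hlim).elim, fun δ hδ hacc => (h δ hδ hacc.1).elim⟩

theorem Acc.congr {E E' : Set Omega1} {ε δ : Omega1} (h : ∀ ξ < ε, ξ ∈ E ↔ ξ ∈ E') (hδ : δ ≤ ε) :
    Acc E δ ↔ Acc E' δ :=
  and_congr_right fun _ => forall₂_congr fun _ _ => exists_congr fun ξ =>
    ⟨fun ⟨h₁, h₂⟩ => ⟨(h ξ (h₂.2.trans_le hδ)).1 h₁, h₂⟩,
      fun ⟨h₁, h₂⟩ => ⟨(h ξ (h₂.2.trans_le hδ)).2 h₁, h₂⟩⟩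

theorem floor_le (E : Set Omega1) (ξ : Omega1) : floor E ξ ≤ ξ := least_le fun _ _ h => h

theorem floor_congr {E E' : Set Omega1} {ξ η : Omega1}
    (h : ∀ x, x ∈ E ∧ x ≤ ξ ↔ x ∈ E' ∧ x ≤ η) : floor E ξ = floor E' η := by
  unfold floor
  congr 1
  funext e
  exact propext (forall_congr' fun x => by rw [← and_imp, h x, and_imp])

theorem floor_eq {E : Set Omega1} {ξ e : Omega1} (he : e ∈ E) (hξ : e ≤ ξ)
    (h : ∀ x ∈ E, x ≤ ξ → x ≤ e) : floor E ξ = e :=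
  (least_le h).antisymm (least_spec (p := fun e => ∀ x ∈ E, x ≤ ξ → x ≤ e) ⟨e, h⟩ e he hξ)

theorem next_mem {E : Set Omega1} {ξ : Omega1} (h : ∃ e ∈ E, ξ < e) : next E ξ ∈ E :=
  (least_spec (p := fun e => e ∈ E ∧ ξ < e) h).1

theorem lt_next {E : Set Omega1} {ξ : Omega1} (h : ∃ e ∈ E, ξ < e) : ξ < next E ξ :=
  (least_spec (p := fun e => e ∈ E ∧ ξ < e) h).2

theorem next_le {E : Set Omega1} {ξ e : Omega1} (he : e ∈ E) (h : ξ < e) : next E ξ ≤ e :=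
  least_le ⟨he, h⟩

theorem next_eq {E : Set Omega1} {ξ e : Omega1} (he : e ∈ E) (h : ξ < e)
    (h' : ∀ x ∈ E, ξ < x → e ≤ x) : next E ξ = e :=
  (next_le he h).antisymm (h' _ (next_mem ⟨e, he, h⟩) (lt_next ⟨e, he, h⟩))

theorem next_congr {E E' : Set Omega1} {ε ξ : Omega1} (h : ∀ ξ < ε, ξ ∈ E ↔ ξ ∈ E')
    (hξ : ∃ x ∈ E, ξ < x ∧ x < ε) : next E ξ = next E' ξ := by
  obtain ⟨x, hx, hξx, hxε⟩ := hξ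
  have hn : next E ξ < ε := (next_le hx hξx).trans_lt hxε
  refine (next_eq ((h _ hn).1 (next_mem ⟨x, hx, hξx⟩)) (lt_next ⟨x, hx, hξx⟩) fun y hy hξy => ?_).symm
  by_contra! hlt
  exact hlt.not_ge (next_le ((h y (hlt.trans hn)).2 hy) hξy)

/-! ### The colouring and the requirements on a limit level -/

namespace Context

variable {C : Omega1 → Set Omega1} (Γ : Context C)

/-- The colouring of the nodes. -/
noncomputable def colour (R : BinSeq → Option Tag) (g : Omega1 → ℕ) (E : Set Omega1)
    (b : BinSeq) : ℕ :=
  -- The label at the start of the gap overrides the default colour at finitely many heights, as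
  -- `idx` is injective below the end of the gap.
  if Γ.idx (next E b.len) b.len ≤ (label R (b.res (floor E b.len))).1 then
    (label R (b.res (floor E b.len))).2
  else g (Γ.pick (next E b.len) b.len)

/-- Up to `δ`, the set `E` is a closed set of limit ordinals, and `g` and `E` are guessed
correctly at the limits of `E`. -/
structure Valid (g : Omega1 → ℕ) (E : Set Omega1) (δ : Omega1) : Prop where
  isSuccLimit : ∀ x ∈ E, IsSuccLimit x
  closed : ∀ ε < δ, Acc E ε → ε ∈ E
  guessed : ∀ ε ≤ δ, Acc E ε →
    ∃ p ∈ Γ.guess ε, (∀ ξ < ε, p.1 ξ = g ξ) ∧ ∀ ξ < ε, ξ ∈ p.2 ↔ ξ ∈ E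

theorem Valid.mono {g : Omega1 → ℕ} {E : Set Omega1} {δ ε : Omega1} (h : Γ.Valid g E δ)
    (hε : ε ≤ δ) : Γ.Valid g E ε :=
  ⟨h.1, fun x hx => h.2 x (hx.trans_le hε), fun x hx => h.3 x (hx.trans hε)⟩

/-- The guessed set is dense in the part of the subtree below `δ`. -/
def IsDenseBelow (R : BinSeq → Option Tag) (g : Omega1 → ℕ) (E : Set Omega1) (δ : Omega1) : Prop :=
  ∀ s ∈ subtree R g E, s.len < δ → ∃ u ∈ Γ.diamond δ, u ∈ subtree R g E ∧ u.len < δ ∧ s ≤ u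

/-- The requirements on the nodes of limit length `δ`. -/
structure Step (R : BinSeq → Option Tag) (δ : Omega1) : Prop where
  countable : {b | b.len = δ ∧ R b ≠ none}.Countable
  support_notMem : ∀ b, b.len = δ → R b ≠ none → b.support ∉ Γ.killed δ
  colour_eq : ∀ g E, ∀ b ∈ subtree R g E, b.len = δ → Acc E δ →
    {ξ ∈ C δ | Γ.colour R g E (b.res ξ) ≠ g δ}.Finite
  sealed : ∀ g E, ∀ b ∈ subtree R g E, b.len = δ → Acc E δ → Γ.IsDenseBelow R g E δ →
    ∃ u ∈ Γ.diamond δ, u ≤ b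
  extend : ∀ g E, Γ.Valid g E δ → Acc E δ → ∀ s ∈ subtree R g E, s.len < δ →
    ∀ F : Set Omega1, F.Finite → ∀ n ℓ, ∃ b ∈ subtree R g E, b.len = δ ∧ s ≤ b ∧ label R b = ℓ ∧
      ∀ ξ ∈ F, next E s.len ≤ ξ → ξ < δ → Γ.colour R g E (b.res ξ) = n
  extend_tree : ∀ s ∈ tree R, s.len < δ → ∀ ℓ, ∃ b ∈ tree R, b.len = δ ∧ s ≤ b ∧ label R b = ℓ

end Context

/-! ### Locality in the labelling and in the guess -/

section Congr

variable {R R' : BinSeq → Option Tag} {δ : Omega1}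

theorem tree_congr (h : ∀ b, b.len ≤ δ → R b = R' b) {b : BinSeq} (hb : b.len ≤ δ) :
    b ∈ tree R ↔ b ∈ tree R' :=
  forall₂_congr fun ε hε => by
    rw [h _ ((BinSeq.len_res hε).trans_le (hε.trans hb))]

theorem subtree_congr (h : ∀ b, b.len ≤ δ → R b = R' b) (g : Omega1 → ℕ) (E : Set Omega1)
    {b : BinSeq} (hb : b.len ≤ δ) : b ∈ subtree R g E ↔ b ∈ subtree R' g E :=
  and_congr (tree_congr h hb) <| forall₂_congr fun ε hε => by
    rw [h _ ((BinSeq.len_res hε).trans_le (hε.trans hb))]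

theorem label_congr (h : ∀ b, b.len ≤ δ → R b = R' b) {b : BinSeq} (hb : b.len ≤ δ) :
    label R b = label R' b := by
  rw [label, label, h b hb]

theorem Context.colour_congr {C : Omega1 → Set Omega1} (Γ : Context C)
    (h : ∀ b, b.len ≤ δ → R b = R' b) (g : Omega1 → ℕ) (E : Set Omega1)
    {b : BinSeq} (hb : b.len ≤ δ) : Γ.colour R g E b = Γ.colour R' g E b := by
  rw [colour, colour, label_congr h ((BinSeq.len_mono (b.res_le _)).trans hb)]

/-- The bound on the length is strict because a tag at height `ε` also speaks of `g ε`, while a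
guess at `δ` says nothing about `g δ`. -/
theorem subtree_congr_guess {g g' : Omega1 → ℕ} {E E' : Set Omega1}
    (hg : ∀ ξ < δ, g ξ = g' ξ) (hE : ∀ ξ < δ, ξ ∈ E ↔ ξ ∈ E')
    {b : BinSeq} (hb : b.len < δ) : b ∈ subtree R g E ↔ b ∈ subtree R g' E' := by
  refine and_congr_right fun _ => forall₂_congr fun ε hε => ?_
  have hεδ := hε.trans_lt hb
  refine imp_congr (Acc.congr hE hεδ.le) (exists_congr fun t => and_congr_right fun _ => ?_)
  exact and_congr (forall₂_congr fun ξ hξ => by rw [hg ξ (hξ.trans_lt hεδ)])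
    (forall₂_congr fun ξ hξ => by rw [hE ξ (hξ.trans hεδ)])

/-- Since `E` accumulates at `δ`, the end of the gap is below `δ`, and `pick` does not exceed it; so
only values below `δ` are read. -/
theorem Context.colour_congr_guess {C : Omega1 → Set Omega1} (Γ : Context C)
    {g g' : Omega1 → ℕ} {E E' : Set Omega1}
    (hg : ∀ ξ < δ, g ξ = g' ξ) (hE : ∀ ξ < δ, ξ ∈ E ↔ ξ ∈ E') (hacc : Acc E δ)
    {b : BinSeq} (hb : b.len < δ) : Γ.colour R g E b = Γ.colour R g' E' b := by
  have hf : floor E b.len = floor E' b.len :=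
    floor_congr fun x => and_congr_left fun hx => hE x (hx.trans_lt hb)
  obtain ⟨x, hx, hbx, hxδ⟩ := hacc.2 _ hb
  have hn : next E b.len = next E' b.len := next_congr hE ⟨x, hx, hbx, hxδ⟩
  have hp : g (Γ.pick (next E b.len) b.len) = g' (Γ.pick (next E b.len) b.len) :=
    hg _ ((Γ.pick_le _ _).trans_lt ((next_le hx hbx).trans_lt hxδ))
  rw [colour, colour, hp, hf, hn]

/-- The requirements at `δ` involve only nodes of length at most `δ`, so later stages of the
recursion cannot spoil them. -/
theorem Context.Step.congr {C : Omega1 → Set Omega1} {Γ : Context C}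
    (h : ∀ b, b.len ≤ δ → R b = R' b) (hR : Γ.Step R δ) :
    Γ.Step R' δ := by
  have hres : ∀ {b : BinSeq} {ξ : Omega1}, b.len = δ → (b.res ξ).len ≤ δ := by
    intro b ξ hb
    exact (BinSeq.len_mono (b.res_le ξ)).trans hb.le
  refine ⟨?_, ?_, ?_, ?_, ?_, ?_⟩
  · refine hR.countable.mono ?_
    rintro b ⟨hb, hb'⟩
    exact ⟨hb, by rwa [h b hb.le]⟩
  · intro b hb hb'
    rw [← h b hb.le] at hb'
    exact hR.support_notMem b hb hb'
  · intro g E b hb hlen hacc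
    refine (hR.colour_eq g E b ((subtree_congr h g E hlen.le).2 hb) hlen hacc).subset ?_
    intro ξ hξ
    refine ⟨hξ.1, ?_⟩
    rw [Γ.colour_congr h g E (hres hlen)]
    exact hξ.2
  · intro g E b hb hlen hacc hd
    refine hR.sealed g E b ((subtree_congr h g E hlen.le).2 hb) hlen hacc fun s hs hsδ => ?_
    obtain ⟨u, hu, hu', huδ, hsu⟩ := hd s ((subtree_congr h g E hsδ.le).1 hs) hsδ
    exact ⟨u, hu, (subtree_congr h g E huδ.le).2 hu', huδ, hsu⟩
  · intro g E hV hacc s hs hsδ F hF n ℓ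
    obtain ⟨b, hb, hlen, hsb, hl, hc⟩ :=
      hR.extend g E hV hacc s ((subtree_congr h g E hsδ.le).2 hs) hsδ F hF n ℓ
    refine ⟨b, (subtree_congr h g E hlen.le).1 hb, hlen, hsb, ?_, fun ξ hξ h₁ h₂ => ?_⟩
    · rw [← label_congr h hlen.le, hl]
    · rw [← Γ.colour_congr h g E (hres hlen), hc ξ hξ h₁ h₂]
  · intro s hs hsδ ℓ
    obtain ⟨b, hb, hlen, hsb, hl⟩ := hR.extend_tree s ((tree_congr h hsδ.le).2 hs) hsδ ℓ
    exact ⟨b, (tree_congr h hlen.le).1 hb, hlen, hsb, by rw [← label_congr h hlen.le, hl]⟩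

end Congr

/-! ### Extending nodes -/

section Extension

variable {C : Omega1 → Set Omega1} {Γ : Context C} {R : BinSeq → Option Tag}

theorem Context.colour_res (Γ : Context C) (R : BinSeq → Option Tag) (g : Omega1 → ℕ)
    (E : Set Omega1) {b : BinSeq} {ξ : Omega1} (hξ : ξ ≤ b.len) :
    Γ.colour R g E (b.res ξ) =
      if Γ.idx (next E ξ) ξ ≤ (label R (b.res (floor E ξ))).1 then
        (label R (b.res (floor E ξ))).2
      else g (Γ.pick (next E ξ) ξ) := by
  rw [Context.colour, BinSeq.len_res hξ, BinSeq.res_res (floor_le E ξ) hξ]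

theorem exists_tree_extension (β : Omega1) (hR : ∀ ε ≤ β, IsSuccLimit ε → Γ.Step R ε)
    {t : BinSeq} (ht : t ∈ tree R) (htβ : t.len ≤ β) : ∃ t' ∈ tree R, t'.len = β ∧ t ≤ t' := by
  induction β using WellFoundedLT.induction with
  | ind β ih =>
  rcases htβ.eq_or_lt with rfl | hlt
  · exact ⟨t, ht, rfl, le_rfl⟩
  by_cases hlim : IsSuccLimit β
  · obtain ⟨b, hb, hlen, htb, -⟩ := (hR β le_rfl hlim).extend_tree t ht hlt (0, 0)
    exact ⟨b, hb, hlen, htb⟩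
  · rw [not_isSuccLimit_iff] at hlim
    rcases hlim with hmin | hsucc
    · exact absurd hlt hmin.not_lt
    · obtain ⟨γ, hγ⟩ := not_isSuccPrelimit_iff.1 hsucc
      obtain rfl := hγ.succ_eq
      obtain ⟨t', ht', hlen, htt'⟩ := ih γ (lt_succ γ)
        (fun ε hε => hR ε (hε.trans (le_succ γ))) (lt_succ_iff.1 hlt)
      exact ⟨t'.snoc true, snoc_mem_tree ht' _, by rw [BinSeq.len_snoc, hlen],
        htt'.trans (t'.le_snoc _)⟩

/-- The supremum of `E` below `e` belongs to `E`: otherwise it would be an accumulation point of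
`E`, and `E` is closed below `e`. -/
theorem exists_pred_of_not_acc {E : Set Omega1} {e : Omega1} (hcl : ∀ ε < e, Acc E ε → ε ∈ E)
    (hacc : ¬ Acc E e) (he : IsSuccLimit e) (hne : ∃ x ∈ E, x < e) :
    ∃ p ∈ E, p < e ∧ ∀ x ∈ E, x < e → x ≤ p := by
  have hbd : ∃ β < e, ∀ x ∈ E, x < e → x ≤ β := by
    by_contra! h
    exact hacc ⟨he, fun β hβ => by
      obtain ⟨x, hx, hxe, hβx⟩ := h β hβ
      exact ⟨x, hx, hβx, hxe⟩⟩
  obtain ⟨β, hβ, hβ'⟩ := hbd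
  let q : Omega1 → Prop := fun p => ∀ x ∈ E, x < e → x ≤ p
  have hp : q (least q) := least_spec ⟨β, hβ'⟩
  have hpe : least q < e := (least_le (p := q) hβ').trans_lt hβ
  by_cases hmem : least q ∈ E
  · exact ⟨_, hmem, hpe, hp⟩
  have hcof : ∀ γ < least q, ∃ ξ ∈ E, γ < ξ ∧ ξ < least q := fun γ hγ => by
    by_contra! h
    refine (least_le (p := q) (a := γ) fun x hx hxe => ?_).not_gt hγ
    by_contra! hx'
    exact hmem (((hp x hx hxe).antisymm (h x hx hx')) ▸ hx)
  refine absurd (hcl _ hpe ⟨⟨?_, ?_⟩, hcof⟩) hmem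
  · obtain ⟨x, hx, hxe⟩ := hne
    intro hmin
    exact hmem (((hp x hx hxe).antisymm (hmin (hp x hx hxe))) ▸ hx)
  · intro γ hγ
    obtain ⟨ξ, -, h₁, h₂⟩ := hcof γ hγ.1
    exact hγ.2 h₁ h₂

/-- Colours before `next E s.len` may already be fixed by a label at or below `s`; from there on,
labels still to be chosen can prescribe them on a finite set. The induction needs `ℓ` arbitrary,
because the label at the predecessor of `e` in `E` does the colouring. -/
theorem exists_extension {g : Omega1 → ℕ} {E : Set Omega1} (e : Omega1)
    (hR : ∀ ε ≤ e, IsSuccLimit ε → Γ.Step R ε) (hV : Γ.Valid g E e) (he : e ∈ E)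
    {s : BinSeq} (hs : s ∈ subtree R g E) (hse : s.len < e) {F : Set Omega1} (hF : F.Finite)
    (n : ℕ) (ℓ : ℕ × ℕ) :
    ∃ b ∈ subtree R g E, b.len = e ∧ s ≤ b ∧ label R b = ℓ ∧
      ∀ ξ ∈ F, next E s.len ≤ ξ → ξ < e → Γ.colour R g E (b.res ξ) = n := by
  induction e using WellFoundedLT.induction generalizing ℓ with
  | ind e ih =>
  have hlim := hV.isSuccLimit e he
  have hStep := hR e le_rfl hlim
  by_cases hacc : Acc E e
  · exact hStep.extend g E hV hacc s hs hse F hF n ℓ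
  by_cases hx : ∃ x ∈ E, s.len < x ∧ x < e
  · obtain ⟨x, hxE, hsx, hxe⟩ := hx
    obtain ⟨p, hpE, hpe, hp⟩ := exists_pred_of_not_acc hV.closed hacc hlim ⟨x, hxE, hxe⟩
    -- With label `(m, n)` at `p`, every point of `F` in `[p, e)` gets colour `n`; the induction
    -- hypothesis treats `F` below `p`.
    obtain ⟨m, hm⟩ := (hF.image (Γ.idx e)).bddAbove
    obtain ⟨t, ht, htlen, hst, htl, htc⟩ := ih p hpe (fun ε hε => hR ε (hε.trans hpe.le))
      (hV.mono _ hpe.le) hpE (hsx.trans_le (hp x hxE hxe)) (m, n)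
    obtain ⟨b, hb, hblen, htb, hbl⟩ := hStep.extend_tree t ht.1 (htlen ▸ hpe) ℓ
    refine ⟨b, mem_subtree_of_not_acc ht htb hb fun δ hδ hδe hδacc => ?_, hblen, hst.trans htb,
      hbl, fun ξ hξ hξ' hξe => ?_⟩
    · obtain ⟨y, hy, hpy, hyδ⟩ := hδacc.2 _ hδ
      exact (hp y hy (hyδ.trans_le (hδe.trans hblen.le))).not_gt (htlen ▸ hpy)
    · rcases lt_or_ge ξ p with hξp | hpξ
      · rw [BinSeq.res_of_le htb (htlen ▸ hξp.le)]
        exact htc ξ hξ hξ' hξp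
      · have hn : next E ξ = e := next_eq he hξe fun y hy hξy =>
          le_of_not_gt fun hye => (hp y hy hye).not_gt (hpξ.trans_lt hξy)
        have hf : floor E ξ = p := floor_eq hpE hpξ fun y hy hyξ => hp y hy (hyξ.trans_lt hξe)
        rw [Γ.colour_res R g E (hblen ▸ hξe.le), hn, hf, BinSeq.res_eq htb htlen.symm, htl,
          if_pos (hm ⟨ξ, hξ, rfl⟩)]
  -- Here `e` is the next point of `E` after `s`, so the colour condition is vacuous.
  · obtain ⟨b, hb, hblen, hsb, hbl⟩ := hStep.extend_tree s hs.1 hse ℓ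
    refine ⟨b, mem_subtree_of_not_acc hs hsb hb fun δ hδ hδe hδacc => ?_, hblen, hsb, hbl,
      fun ξ _ hξ' hξe => ?_⟩
    · obtain ⟨y, hy, hsy, hyδ⟩ := hδacc.2 _ hδ
      exact hx ⟨y, hy, hsy, hyδ.trans_le (hδe.trans hblen.le)⟩
    · have hex : ∃ y ∈ E, s.len < y := ⟨e, he, hse⟩
      exact (hx ⟨_, next_mem hex, lt_next hex, hξ'.trans_lt hξe⟩).elim

theorem countable_level (β : Omega1) (hR : ∀ ε ≤ β, IsSuccLimit ε → Γ.Step R ε) :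
    {b ∈ tree R | b.len = β}.Countable := by
  induction β using WellFoundedLT.induction with
  | ind β ih =>
  by_cases hlim : IsSuccLimit β
  · refine (hR β le_rfl hlim).countable.mono ?_
    rintro b ⟨hb, hlen⟩
    refine ⟨hlen, ?_⟩
    have := hb b.len le_rfl (hlen ▸ hlim)
    rwa [BinSeq.res_len] at this
  · rw [not_isSuccLimit_iff] at hlim
    rcases hlim with hmin | hsucc
    · refine Set.Subsingleton.countable fun a ha b hb => BinSeq.ext_injOn (ha.2.trans hb.2.symm) ?_
      intro ξ hξ
      rw [ha.2] at hξ
      exact absurd hξ hmin.not_lt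
    · obtain ⟨γ, hγ⟩ := not_isSuccPrelimit_iff.1 hsucc
      obtain rfl := hγ.succ_eq
      have := ih γ (lt_succ γ) fun ε hε => hR ε (hε.trans (le_succ γ))
      refine ((this.image fun b => b.snoc true).union (this.image fun b => b.snoc false)).mono ?_
      rintro b ⟨hb, hlen⟩
      have hres : b.res γ ∈ {b ∈ tree R | b.len = γ} :=
        ⟨tree_isLowerSet R (b.res_le γ) hb, BinSeq.len_res (hlen ▸ le_succ γ)⟩
      have h := BinSeq.eq_snoc_of_len hlen
      rcases hv : b.ext γ with _ | _
      · rw [hv] at h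
        exact Or.inr ⟨_, hres, h.symm⟩
      · rw [hv] at h
        exact Or.inl ⟨_, hres, h.symm⟩

theorem countable_below {δ : Omega1} (hR : ∀ ε < δ, IsSuccLimit ε → Γ.Step R ε) :
    {b ∈ tree R | b.len < δ}.Countable := by
  refine ((countable_Iio_omega1 δ).biUnion fun β hβ => countable_level (Γ := Γ) (R := R) β
    fun ε hε => hR ε (hε.trans_lt hβ)).mono ?_
  rintro b ⟨hb, hlt⟩
  exact mem_biUnion hlt ⟨hb, rfl⟩

end Extension

/-! ### Constructing a limit level -/

section LimitLevel

variable {C : Omega1 → Set Omega1} {Γ : Context C} {R R' : BinSeq → Option Tag}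

theorem exists_lt_bound {δ : Omega1} {F : Set Omega1} (hF : F.Finite) {a : Omega1} (ha : a < δ) :
    ∃ γ < δ, a ≤ γ ∧ ∀ ξ ∈ F, ξ < δ → ξ ≤ γ := by
  have hfin : (insert a (F ∩ Iio δ)).Finite := (hF.inter_of_left _).insert a
  obtain ⟨γ, hγ, hmax⟩ := exists_max_image _ id hfin (insert_nonempty _ _)
  refine ⟨γ, ?_, hmax a (mem_insert _ _), fun ξ hξ hξδ => hmax ξ (mem_insert_of_mem _ ⟨hξ, hξδ⟩)⟩
  rcases hγ with rfl | h
  · exact ha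
  · exact h.2

theorem mem_tree_of_forall_res {δ : Omega1} {b : BinSeq} (hlen : b.len = δ)
    (hR : ∀ b, b.len < δ → R' b = R b) (hb : ∀ β < δ, b.res β ∈ tree R) (hb' : R' b ≠ none) :
    b ∈ tree R' := by
  intro ε hε hlim
  rw [hlen] at hε
  rcases hε.eq_or_lt with rfl | hlt
  · rwa [← hlen, BinSeq.res_len]
  · have hl : (b.res ε).len = ε := BinSeq.len_res (hlen ▸ hε)
    rw [hR _ (hl.trans_lt hlt)]
    have := hb ε hlt ε hl.ge hlim
    rwa [BinSeq.res_res le_rfl (hlen ▸ hε)] at this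

theorem mem_subtree_of_forall_res {δ : Omega1} {g : Omega1 → ℕ} {E : Set Omega1} {b : BinSeq}
    (hlen : b.len = δ) (hR : ∀ b, b.len < δ → R' b = R b) (hb : ∀ β < δ, b.res β ∈ subtree R g E)
    {t : Tag} (ht : R' b = some t) (hm : Matches δ g E t) : b ∈ subtree R' g E := by
  refine ⟨mem_tree_of_forall_res hlen hR (fun β hβ => (hb β hβ).1) (by simp [ht]), ?_⟩
  intro ε hε hacc
  rw [hlen] at hε
  rcases hε.eq_or_lt with rfl | hlt
  · exact ⟨t, by rw [← hlen, BinSeq.res_len, ht], hm⟩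
  · have hl : (b.res ε).len = ε := BinSeq.len_res (hlen ▸ hε)
    rw [hR _ (hl.trans_lt hlt)]
    have := (hb ε hlt).2 ε hl.ge hacc
    rwa [BinSeq.res_res le_rfl (hlen ▸ hε)] at this

theorem not_countable_tree_branches {δ : Omega1} (hδ : IsSuccLimit δ)
    (hR : ∀ ε < δ, IsSuccLimit ε → Γ.Step R ε) {s : BinSeq} (hs : s ∈ tree R) (hsδ : s.len < δ) :
    ¬ {b : BinSeq | b.len = δ ∧ s ≤ b ∧ ∀ β < δ, b.res β ∈ tree R}.Countable := by
  intro hc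
  refine not_countable_branches hδ (Z := {z | z ∈ tree R ∧ z.len < δ}) (fun z hz => hz.2) ?_
    ⟨hs, hsδ⟩ (hc.mono ?_)
  · rintro z ⟨hz, hzδ⟩ β hβ b
    obtain ⟨t, ht, htlen, hzt⟩ := exists_tree_extension (Γ := Γ) (max z.len β)
      (fun ε hε => hR ε (hε.trans_lt (max_lt hzδ hβ))) hz (le_max_left _ _)
    have htδ : succ t.len < δ := hδ.succ_lt (htlen ▸ max_lt hzδ hβ)
    have key : ∃ i, ¬ t.snoc i ≤ b := by
      by_contra! h
      have := t.snoc_injective (BinSeq.eq_of_le_of_le (h true) (h false) rfl)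
      simp at this
    obtain ⟨i, hi⟩ := key
    refine ⟨t.snoc i, ⟨snoc_mem_tree ht i, htδ⟩, hzt.trans (t.le_snoc i), ?_, hi⟩
    exact (le_max_right _ _).trans (htlen.ge.trans (le_succ _))
  · rintro b ⟨hlen, hsb, hb⟩
    refine ⟨hlen, hsb, fun β hβ => ?_⟩
    obtain ⟨z, hz, hβz, hzb⟩ := hb β hβ
    rw [BinSeq.res_of_le hzb hβz.le]
    exact tree_isLowerSet R (z.res_le β) hz.1

/-- The branches of length `δ` of the subtree that extend `s`, with colours as required. -/
def branches (Γ : Context C) (R : BinSeq → Option Tag) (g : Omega1 → ℕ) (E : Set Omega1)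
    (δ : Omega1) (k : ℕ) (s : BinSeq) (F : Set Omega1) (n : ℕ) : Set BinSeq :=
  {b | b.len = δ ∧ s ≤ b ∧ (∀ β < δ, b.res β ∈ subtree R g E) ∧
    {ξ ∈ C δ | Γ.colour R g E (b.res ξ) ≠ k}.Finite ∧
    (Γ.IsDenseBelow R g E δ → ∃ u ∈ Γ.diamond δ, u ≤ b) ∧
    ∀ ξ ∈ F, next E s.len ≤ ξ → ξ < δ → Γ.colour R g E (b.res ξ) = n}

/-- The colour `k` is a separate parameter, standing for `g δ`, which agreement below `δ` does not
determine. -/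
theorem branches_subset_of_agree {g g' : Omega1 → ℕ} {E E' : Set Omega1} {δ : Omega1}
    (hg : ∀ ξ < δ, g ξ = g' ξ) (hE : ∀ ξ < δ, ξ ∈ E ↔ ξ ∈ E') (hacc : Acc E δ) (k : ℕ)
    {s : BinSeq} (hs : s.len < δ) (F : Set Omega1) (n : ℕ) :
    branches Γ R g E δ k s F n ⊆ branches Γ R g' E' δ k s F n := by
  rintro b ⟨hlen, hsb, hres, hcol, hseal, hF⟩
  have hlt : ∀ ξ < δ, (b.res ξ).len < δ := fun ξ hξ => by
    rwa [BinSeq.len_res (hlen ▸ hξ.le)]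
  refine ⟨hlen, hsb, fun β hβ => (subtree_congr_guess hg hE (hlt β hβ)).1 (hres β hβ), ?_, ?_, ?_⟩
  · refine hcol.subset ?_
    rintro ξ ⟨hξ, hne⟩
    refine ⟨hξ, ?_⟩
    rwa [Γ.colour_congr_guess hg hE hacc (hlt ξ (Γ.ladder_lt δ hacc.1 ξ hξ))]
  · refine fun hd => hseal fun t ht htδ => ?_
    obtain ⟨u, hu, hu', huδ, htu⟩ := hd t ((subtree_congr_guess hg hE htδ).1 ht) htδ
    exact ⟨u, hu, (subtree_congr_guess hg hE huδ).2 hu', huδ, htu⟩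
  · intro ξ hξ h₁ h₂
    rw [← Γ.colour_congr_guess hg hE hacc (hlt ξ h₂)]
    refine hF ξ hξ ?_ h₂
    rwa [next_congr hE]
    exact hacc.2 _ hs

/-- Climb past `F` with colour `n`, then into the guessed dense set, and from there through heights
in `E` with all further ladder points coloured `k`. Ladder points below the start of this last climb
are finitely many and do not matter. -/
theorem not_countable_branches_subtree {g : Omega1 → ℕ} {E : Set Omega1} {δ : Omega1}
    (hR : ∀ ε < δ, IsSuccLimit ε → Γ.Step R ε) (hV : Γ.Valid g E δ) (hacc : Acc E δ)
    (k : ℕ) {s : BinSeq} (hs : s ∈ subtree R g E) (hsδ : s.len < δ) {F : Set Omega1}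
    (hF : F.Finite) (n : ℕ) : ¬ (branches Γ R g E δ k s F n).Countable := by
  have hext : ∀ e ∈ E, e < δ → ∀ t ∈ subtree R g E, t.len < e → ∀ (F : Set Omega1), F.Finite →
      ∀ n ℓ, ∃ b ∈ subtree R g E, b.len = e ∧ t ≤ b ∧ label R b = ℓ ∧
        ∀ ξ ∈ F, next E t.len ≤ ξ → ξ < e → Γ.colour R g E (b.res ξ) = n :=
    fun e he heδ t ht hte F hF n ℓ => exists_extension e
      (fun ε hε => hR ε (hε.trans_lt heδ)) (hV.mono _ heδ.le) he ht hte hF n ℓ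
  have hnext : ∀ e < δ, e < next E e ∧ next E e < δ := fun e he => by
    obtain ⟨x, hx, hex, hxδ⟩ := hacc.2 e he
    exact ⟨lt_next ⟨x, hx, hex⟩, (next_le hx hex).trans_lt hxδ⟩
  have hidx : ∀ e < δ, ∃ m, ∀ ξ ∈ C δ, ξ < next E e → Γ.idx (next E e) ξ ≤ m := fun e he => by
    obtain ⟨m, hm⟩ := ((Γ.ladder_finite δ hacc.1 _ (hnext e he).2).image
      (Γ.idx (next E e))).bddAbove
    exact ⟨m, fun ξ hξ hξe => hm ⟨ξ, ⟨hξ, hξe.le⟩, rfl⟩⟩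
  -- a node beyond `F`
  obtain ⟨γ, hγδ, hsγ, hFγ⟩ := exists_lt_bound hF hsδ
  obtain ⟨e₀, he₀, hγe₀, he₀δ⟩ := hacc.2 γ hγδ
  obtain ⟨s₀, hs₀, hs₀len, hss₀, -, hs₀F⟩ :=
    hext e₀ he₀ he₀δ s hs (hsγ.trans_lt hγe₀) F hF n (0, 0)
  -- a node above the guessed dense set
  obtain ⟨u, hu, huδ, hs₀u, hud⟩ : ∃ u ∈ subtree R g E, u.len < δ ∧ s₀ ≤ u ∧
      (Γ.IsDenseBelow R g E δ → u ∈ Γ.diamond δ) := by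
    by_cases hd : Γ.IsDenseBelow R g E δ
    · obtain ⟨u, hu, hu', huδ, h⟩ := hd s₀ hs₀ (hs₀len ▸ he₀δ)
      exact ⟨u, hu', huδ, h, fun _ => hu⟩
    · exact ⟨s₀, hs₀, hs₀len ▸ he₀δ, le_rfl, fun h => (hd h).elim⟩
  -- a node with a suitable label
  obtain ⟨e₁, he₁, hue₁, he₁δ⟩ := hacc.2 _ huδ
  obtain ⟨m₁, hm₁⟩ := hidx e₁ he₁δ
  obtain ⟨z₀, hz₀, hz₀len, huz₀, hz₀l, -⟩ := hext e₁ he₁ he₁δ u hu hue₁ ∅ finite_empty 0 (m₁, k)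
  -- The label of a node in `Z` already forces `k` on the ladder points of the gap that starts
  -- there, which extensions can no longer influence.
  let Z : Set BinSeq := {z | z ∈ subtree R g E ∧ z.len ∈ E ∧ z.len < δ ∧ z₀ ≤ z ∧
    (label R z).2 = k ∧
    (∀ ξ ∈ C δ, ξ < next E z.len → Γ.idx (next E z.len) ξ ≤ (label R z).1) ∧
    ∀ ξ ∈ C δ, z₀.len ≤ ξ → ξ < z.len → Γ.colour R g E (z.res ξ) = k}
  have hz₀Z : z₀ ∈ Z := by
    refine ⟨hz₀, hz₀len ▸ he₁, hz₀len ▸ he₁δ, le_rfl, by rw [hz₀l], ?_, ?_⟩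
    · rw [hz₀l, hz₀len]
      exact hm₁
    · exact fun ξ _ h₁ h₂ => (h₁.not_gt h₂).elim
  have hZ : ∀ z ∈ Z, ∀ β < δ, ∀ b : BinSeq, ∃ z' ∈ Z, z ≤ z' ∧ β ≤ z'.len ∧ ¬ z' ≤ b := by
    rintro z ⟨hz, hzE, hzδ, hz₀z, hzk, hzidx, hzcol⟩ β hβ b
    obtain ⟨e, he, hme, heδ⟩ := hacc.2 _ (max_lt hzδ hβ)
    have hze : z.len < e := (le_max_left _ _).trans_lt hme
    obtain ⟨m, hm⟩ := hidx e heδ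
    -- Ladder points below `z.len` are right by assumption on `z`, those in the next gap by the
    -- label of `z`, and the finitely many later ones by the finite colour condition.
    have claim : ∀ m', m ≤ m' → ∃ t ∈ Z, z ≤ t ∧ t.len = e ∧ label R t = (m', k) := by
      intro m' hm'
      obtain ⟨t, ht, htlen, hzt, htl, htc⟩ := hext e he heδ z hz hze {ξ ∈ C δ | ξ ≤ e}
        (Γ.ladder_finite δ hacc.1 e heδ) k (m', k)
      refine ⟨t, ⟨ht, htlen ▸ he, htlen ▸ heδ, hz₀z.trans hzt, by rw [htl], ?_, ?_⟩, hzt, htlen,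
        htl⟩
      · rw [htl, htlen]
        exact fun ξ hξ h => (hm ξ hξ h).trans hm'
      · intro ξ hξ hξ₀ hξe
        rw [htlen] at hξe
        rcases lt_or_ge ξ z.len with hξz | hzξ
        · rw [BinSeq.res_of_le hzt hξz.le]
          exact hzcol ξ hξ hξ₀ hξz
        rcases lt_or_ge ξ (next E z.len) with hξn | hnξ
        · have hgap : ∀ x ∈ E, x ≤ ξ → x ≤ z.len := fun x hx hxξ => by
            by_contra! h
            exact (next_le hx h).not_gt (hxξ.trans_lt hξn)
          have hn : next E ξ = next E z.len :=
            next_eq (next_mem ⟨e, he, hze⟩) hξn fun x hx hξx => next_le hx (hzξ.trans_lt hξx)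
          rw [Γ.colour_res R g E (htlen ▸ hξe.le), hn, floor_eq hzE hzξ hgap,
            BinSeq.res_eq hzt rfl, if_pos (hzidx ξ hξ hξn), hzk]
        · exact htc ξ ⟨hξ, hξe.le⟩ hnξ hξe
    -- Different labels make two distinct nodes of equal length, and at most one of them lies below
    -- `b`.
    obtain ⟨t₁, ht₁, hzt₁, hlen₁, hl₁⟩ := claim m le_rfl
    obtain ⟨t₂, ht₂, hzt₂, hlen₂, hl₂⟩ := claim (m + 1) m.le_succ
    have hβe : β ≤ e := (le_max_right _ _).trans hme.le
    by_cases h₁ : t₁ ≤ b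
    · refine ⟨t₂, ht₂, hzt₂, hlen₂ ▸ hβe, fun h₂ => ?_⟩
      have := BinSeq.eq_of_le_of_le h₁ h₂ (hlen₁.trans hlen₂.symm)
      rw [this, hl₂] at hl₁
      simp at hl₁
    · exact ⟨t₁, ht₁, hzt₁, hlen₁ ▸ hβe, h₁⟩
  intro hc
  refine not_countable_branches hacc.1 (fun z hz => hz.2.2.1) hZ hz₀Z (hc.mono ?_)
  rintro b ⟨hlen, hz₀b, hb⟩
  have hub : u ≤ b := huz₀.trans hz₀b
  have hs₀b : s₀ ≤ b := hs₀u.trans hub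
  refine ⟨hlen, hss₀.trans hs₀b, fun β hβ => ?_, ?_, fun hd => ⟨u, hud hd, hub⟩, ?_⟩
  · obtain ⟨z, hz, hβz, hzb⟩ := hb β hβ
    rw [BinSeq.res_of_le hzb hβz.le]
    exact subtree_isLowerSet R g E (z.res_le β) hz.1
  · refine (Γ.ladder_finite δ hacc.1 z₀.len (hz₀len ▸ he₁δ)).subset ?_
    rintro ξ ⟨hξ, hne⟩
    refine ⟨hξ, le_of_not_gt fun hlt => hne ?_⟩
    obtain ⟨z, hz, hξz, hzb⟩ := hb ξ (Γ.ladder_lt δ hacc.1 ξ hξ)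
    rw [BinSeq.res_of_le hzb hξz.le]
    exact hz.2.2.2.2.2.2 ξ hξ hlt.le hξz
  · intro ξ hξ h₁ h₂
    have hξe : ξ < e₀ := (hFγ ξ hξ h₂).trans_lt hγe₀
    rw [BinSeq.res_of_le hs₀b (hs₀len ▸ hξe.le)]
    exact hs₀F ξ hξ h₁ hξe

end LimitLevel

section Labelling

variable {C : Omega1 → Set Omega1} (Γ : Context C) {R : BinSeq → Option Tag}

/-- Every satisfiable demand has uncountably many candidate branches, so distinct branches outside
`killed δ` can be chosen for all of them. By distinctness a branch can carry the tag of its own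
demand. -/
theorem exists_step {δ : Omega1} (hδ : IsSuccLimit δ)
    (hR : ∀ ε < δ, IsSuccLimit ε → Γ.Step R ε) :
    ∃ R' : BinSeq → Option Tag, (∀ b, b.len ≠ δ → R' b = R b) ∧ Γ.Step R' δ := by
  classical
  let N : Set BinSeq := {b ∈ tree R | b.len < δ}
  let FS : Set (Set Omega1) := {F | F.Finite ∧ F ⊆ Iio δ}
  have hN : Countable N := (countable_below hR).to_subtype
  have hFS : Countable FS := (countable_ofPred_finite_subset (countable_Iio_omega1 δ)).to_subtype
  have hG : Countable (Γ.guess δ) := (Γ.guess_countable δ).to_subtype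
  -- A guess covers only values below `δ`, so each possible value at `δ` is a separate demand.
  -- Demands of the second kind concern the whole tree; their guess `∅` is never right at an
  -- accumulation point.
  let tag : (Γ.guess δ × ℕ × N × FS × ℕ × (ℕ × ℕ)) ⊕ (N × (ℕ × ℕ)) → Tag :=
    Sum.elim (fun i => (Function.update i.1.1.1 δ i.2.1, i.1.1.2, i.2.2.2.2.2))
      (fun i => (fun _ => 0, ∅, i.2))
  let B : (Γ.guess δ × ℕ × N × FS × ℕ × (ℕ × ℕ)) ⊕ (N × (ℕ × ℕ)) → Set BinSeq :=
    Sum.elim (fun i => branches Γ R i.1.1.1 i.1.1.2 δ i.2.1 i.2.2.1 i.2.2.2.1 i.2.2.2.2.1)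
      (fun i => {b | b.len = δ ∧ i.1.1 ≤ b ∧ ∀ β < δ, b.res β ∈ tree R})
  have hV : {b : BinSeq | b.len = δ ∧ b.support ∈ Γ.killed δ}.Countable :=
    MapsTo.countable_of_injOn (f := BinSeq.support) (t := Γ.killed δ) (fun b hb => hb.2)
      (fun a ha b hb h => BinSeq.eq_of_support_eq (ha.1.trans hb.1.symm) h) (Γ.killed_countable δ)
  -- Demands with only countably many candidates, as may arise from wrong guesses, are dropped.
  obtain ⟨f, hf, hfB⟩ := exists_injective_choice (ι := {i // ¬ (B i).Countable})
    (fun i => B i.1) (fun i => i.2) hV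
  have hlen : ∀ i, (f i).len = δ := by
    rintro ⟨i | i, hi⟩
    · exact (hfB ⟨_, hi⟩).1.1
    · exact (hfB ⟨_, hi⟩).1.1
  have hBtree : ∀ i, ∀ β < δ, (f i).res β ∈ tree R := by
    rintro ⟨i | i, hi⟩ β hβ
    · exact ((hfB ⟨_, hi⟩).1.2.2.1 β hβ).1
    · exact (hfB ⟨_, hi⟩).1.2.2 β hβ
  let R' : BinSeq → Option Tag := fun b =>
    if b.len = δ then if h : ∃ i, f i = b then some (tag h.choose.1) else none else R b
  have hR'f : ∀ i, R' (f i) = some (tag i.1) := fun i => by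
    have h : ∃ j, f j = f i := ⟨i, rfl⟩
    simp only [R', if_pos (hlen i), dif_pos h]
    rw [hf h.choose_spec]
  have hR'inv : ∀ b, b.len = δ → R' b ≠ none → ∃ i, f i = b := fun b hb hne => by
    by_contra h
    simp only [R', if_pos hb, dif_neg h] at hne
    exact hne rfl
  have hR'R : ∀ b, b.len ≠ δ → R' b = R b := fun b hb => by simp only [R', if_neg hb]
  have hlt : ∀ b, b.len < δ → R' b = R b := fun b hb => hR'R b hb.ne
  have hle : ∀ {β : Omega1}, β < δ → ∀ b, b.len ≤ β → R' b = R b := fun hβ b hb =>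
    hlt b (hb.trans_lt hβ)
  have hreslt : ∀ {b : BinSeq} {ξ : Omega1}, b.len = δ → ξ < δ → (b.res ξ).len < δ := by
    intro b ξ hb hξ
    rwa [BinSeq.len_res (hb ▸ hξ.le)]
  have hcol : ∀ g E (b : BinSeq) (ξ : Omega1), b.len = δ → ξ < δ →
      Γ.colour R' g E (b.res ξ) = Γ.colour R g E (b.res ξ) := fun g E b ξ hb hξ =>
    Γ.colour_congr (hle (hreslt hb hξ)) g E le_rfl
  have hbr : ∀ g E, ∀ b ∈ subtree R' g E, b.len = δ → Acc E δ →
      ∃ s F n, b ∈ branches Γ R g E δ (g δ) s F n := by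
    intro g E b hb hbδ hacc
    obtain ⟨t, ht, hm⟩ := hb.2 δ hbδ.ge hacc
    rw [← hbδ, BinSeq.res_len] at ht
    obtain ⟨i, rfl⟩ := hR'inv b hbδ (by simp [ht])
    rw [hR'f] at ht
    obtain rfl := Option.some_injective _ ht
    obtain ⟨i | i, hi⟩ := i
    · have hE : ∀ ξ < δ, ξ ∈ i.1.1.2 ↔ ξ ∈ E := hm.2
      have hg : ∀ ξ < δ, i.1.1.1 ξ = g ξ := fun ξ hξ => by
        rw [← hm.1 ξ hξ.le]
        exact (Function.update_of_ne hξ.ne _ _).symm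
      have hk : i.2.1 = g δ := by
        rw [← hm.1 δ le_rfl]
        exact (Function.update_self δ i.2.1 i.1.1.1).symm
      refine ⟨i.2.2.1, i.2.2.2.1, i.2.2.2.2.1, ?_⟩
      rw [← hk]
      exact branches_subset_of_agree hg hE ((Acc.congr hE le_rfl).2 hacc) _ i.2.2.1.2.2 _ _
        (hfB ⟨_, hi⟩).1
    · obtain ⟨x, hx⟩ := hδ.nonempty_Iio
      obtain ⟨y, hy, -, hyδ⟩ := hacc.2 x hx
      exact ((hm.2 y hyδ).2 hy).elim
  refine ⟨R', hR'R, ?_, ?_, ?_, ?_, ?_, ?_⟩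
  · refine (countable_range f).mono ?_
    rintro b ⟨hb, hne⟩
    exact hR'inv b hb hne
  · intro b hb hne hk
    obtain ⟨i, rfl⟩ := hR'inv b hb hne
    exact (hfB i).2 ⟨hb, hk⟩
  · intro g E b hb hbδ hacc
    obtain ⟨s, F, n, h⟩ := hbr g E b hb hbδ hacc
    refine h.2.2.2.1.subset ?_
    rintro ξ ⟨hξ, hne⟩
    refine ⟨hξ, ?_⟩
    rwa [← hcol g E b ξ hbδ (Γ.ladder_lt δ hδ ξ hξ)]
  · intro g E b hb hbδ hacc hd
    obtain ⟨s, F, n, h⟩ := hbr g E b hb hbδ hacc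
    refine h.2.2.2.2.1 fun t ht htδ => ?_
    obtain ⟨u, hu, hu', huδ, htu⟩ := hd t ((subtree_congr (hle htδ) g E le_rfl).2 ht) htδ
    exact ⟨u, hu, (subtree_congr (hle huδ) g E le_rfl).1 hu', huδ, htu⟩
  · intro g E hVal hacc s hs hsδ F hF n ℓ
    have hsR := (subtree_congr (hle hsδ) g E le_rfl).1 hs
    obtain ⟨p, hp, hpg, hpE⟩ := hVal.guessed δ le_rfl hacc
    have hunc := not_countable_branches_subtree hR hVal hacc (g δ) hsR hsδ
      (hF.inter_of_left (Iio δ)) n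
    have hsub : branches Γ R g E δ (g δ) s (F ∩ Iio δ) n ⊆
        branches Γ R p.1 p.2 δ (g δ) s (F ∩ Iio δ) n :=
      branches_subset_of_agree (fun ξ hξ => (hpg ξ hξ).symm) (fun ξ hξ => (hpE ξ hξ).symm) hacc _
        hsδ _ _
    let i : (Γ.guess δ × ℕ × N × FS × ℕ × (ℕ × ℕ)) ⊕ (N × (ℕ × ℕ)) :=
      Sum.inl (⟨p, hp⟩, g δ, ⟨s, hsR.1, hsδ⟩, ⟨F ∩ Iio δ, hF.inter_of_left _, inter_subset_right⟩,
        n, ℓ)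
    -- Uncountability is known for `g` and `E`, and passes to the guess `p`, which agrees with them
    -- below `δ`.
    have hi : ¬ (B i).Countable := fun h => hunc (h.mono hsub)
    have hb : f ⟨i, hi⟩ ∈ branches Γ R g E δ (g δ) s (F ∩ Iio δ) n :=
      branches_subset_of_agree hpg hpE ((Acc.congr hpE le_rfl).2 hacc) _ hsδ _ _ (hfB ⟨i, hi⟩).1
    have htag := hR'f ⟨i, hi⟩
    refine ⟨f ⟨i, hi⟩, mem_subtree_of_forall_res (hlen _) hlt hb.2.2.1 htag ⟨?_, hpE⟩, hlen _,
      hb.2.1, ?_, ?_⟩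
    · intro ξ hξ
      rcases hξ.eq_or_lt with rfl | h
      · exact Function.update_self _ _ _
      · exact (Function.update_of_ne h.ne _ _).trans (hpg ξ h)
    · rw [label, htag]
      rfl
    · intro ξ hξ h₁ h₂
      rw [hcol g E _ ξ (hlen _) h₂]
      exact hb.2.2.2.2.2 ξ ⟨hξ, h₂⟩ h₁ h₂
  · intro s hs hsδ ℓ
    have hsR := (tree_congr (hle hsδ) le_rfl).1 hs
    let i : (Γ.guess δ × ℕ × N × FS × ℕ × (ℕ × ℕ)) ⊕ (N × (ℕ × ℕ)) :=
      Sum.inr (⟨s, hsR, hsδ⟩, ℓ)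
    have hi : ¬ (B i).Countable := not_countable_tree_branches hδ hR hsR hsδ
    have htag := hR'f ⟨i, hi⟩
    refine ⟨f ⟨i, hi⟩, mem_tree_of_forall_res (hlen _) hlt (hBtree _) (by simp [htag]), hlen _,
      (hfB ⟨i, hi⟩).1.2.1, ?_⟩
    rw [label, htag]
    rfl

/-- There is a labelling that meets the requirements at all limit levels. -/
theorem exists_labelling :
    ∃ R : BinSeq → Option Tag, ∀ δ, IsSuccLimit δ → Γ.Step R δ := by
  classical
  let glue : (Omega1 → BinSeq → Option Tag) → BinSeq → Option Tag := fun f b => f b.len b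
  let set : (Omega1 → BinSeq → Option Tag) → Omega1 → (BinSeq → Option Tag) → BinSeq → Option Tag :=
    fun f δ v b => if b.len = δ then v b else glue f b
  -- The condition presupposes success at earlier levels, so that it can always be met.
  obtain ⟨f, hf⟩ := exists_wf_recursion
    (fun δ (f : Omega1 → BinSeq → Option Tag) (v : BinSeq → Option Tag) => IsSuccLimit δ →
      (∀ ε < δ, IsSuccLimit ε → Γ.Step (glue f) ε) → Γ.Step (set f δ v) δ)
    (fun δ f => by
      by_cases h : IsSuccLimit δ ∧ ∀ ε < δ, IsSuccLimit ε → Γ.Step (glue f) ε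
      · obtain ⟨R', h₁, h₂⟩ := exists_step Γ h.1 h.2
        refine ⟨R', fun _ _ => ?_⟩
        convert h₂ using 1
        funext b
        by_cases hb : b.len = δ
        · simp only [set, if_pos hb]
        · simp only [set, if_neg hb, h₁ b hb]
      · exact ⟨fun _ => none, fun h₁ h₂ => (h ⟨h₁, h₂⟩).elim⟩)
    (fun δ f f' v hff' hP hlim hstep => by
      have hglue : ∀ b : BinSeq, b.len < δ → glue f b = glue f' b := fun b hb => by
        simp only [glue, hff' _ hb]
      refine (hP hlim fun ε hε hε' => (hstep ε hε hε').congr fun b hb =>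
        (hglue b (hb.trans_lt hε)).symm).congr fun b hb => ?_
      rcases hb.eq_or_lt with h | h
      · simp only [set, if_pos h]
      · simp only [set, if_neg h.ne, hglue b h])
  refine ⟨glue f, fun δ => ?_⟩
  induction δ using WellFoundedLT.induction with
  | ind δ ih =>
  intro hlim
  refine (hf δ hlim ih).congr fun b _ => ?_
  by_cases hb : b.len = δ
  · simp only [set, if_pos hb, glue, hb]
  · simp only [set, if_neg hb]

end Labelling

/-! ### Guessing principles -/

theorem IsLadderSystem.finite_le {C : Omega1 → Set Omega1} (hC : IsLadderSystem C) {α β : Omega1}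
    (hα : IsSuccLimit α) (hβ : β < α) : {ξ ∈ C α | ξ ≤ β}.Finite := by
  obtain ⟨-, hcof, ⟨e⟩⟩ := hC α hα
  obtain ⟨γ, hβγ, hγ⟩ := (not_covBy_iff hβ).1 (hα.2 β)
  obtain ⟨c, hc, hγc⟩ := hcof γ hγ
  refine ((finite_Iio (e ⟨c, hc⟩)).image fun n => (e.symm n).1).subset ?_
  rintro ξ ⟨hξ, hξβ⟩
  refine ⟨e ⟨ξ, hξ⟩, ?_, by simp⟩
  exact e.lt_iff_lt.2 (Subtype.mk_lt_mk.2 ((hξβ.trans_lt hβγ).trans_le hγc))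

theorem IsLadderSystem.finite_inter {C : Omega1 → Set Omega1} (hC : IsLadderSystem C)
    {α β : Omega1} (hα : IsSuccLimit α) (hβ : IsSuccLimit β) (hne : α ≠ β) :
    (C α ∩ C β).Finite := by
  rcases lt_or_gt_of_ne hne with h | h
  · exact (hC.finite_le hβ h).subset fun ξ hξ => ⟨hξ.2, ((hC α hα).1 hξ.1).le⟩
  · exact (hC.finite_le hα h).subset fun ξ hξ => ⟨hξ.1, ((hC β hβ).1 hξ.2).le⟩

theorem exists_idx : ∃ idx : Omega1 → Omega1 → ℕ, ∀ β, InjOn (idx β) (Iic β) := by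
  have h : ∀ β : Omega1, ∃ f : Omega1 → ℕ, InjOn f (Iic β) := fun β =>
    countable_iff_exists_injOn.1 (countable_Iic_omega1 β)
  choose idx h using h
  exact ⟨idx, h⟩

/-- Distinct ladders have finite intersection. Giving `ξ` to the ladder of least index containing it
costs `C α` only points shared with finitely many ladders. -/
theorem IsLadderSystem.exists_pick {C : Omega1 → Set Omega1} (hC : IsLadderSystem C) :
    ∃ pick : Omega1 → Omega1 → Omega1, (∀ β ξ, pick β ξ ≤ β) ∧
      ∀ β α, IsSuccLimit α → α ≤ β → {ξ ∈ C α | pick β ξ ≠ α}.Finite := by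
  obtain ⟨idx, hidx⟩ := exists_idx
  have h : ∀ β ξ : Omega1, ∃ a ≤ β, ∀ α ≤ β, IsSuccLimit α → ξ ∈ C α →
      IsSuccLimit a ∧ ξ ∈ C a ∧ idx β a ≤ idx β α := by
    intro β ξ
    let A : Set Omega1 := {α | α ≤ β ∧ IsSuccLimit α ∧ ξ ∈ C α}
    rcases A.eq_empty_or_nonempty with hA | hA
    · refine ⟨β, le_rfl, fun α h₁ h₂ h₃ => ?_⟩
      have : α ∈ A := ⟨h₁, h₂, h₃⟩
      rw [hA] at this
      exact this.elim
    · have hmem := Function.argminOn_mem (idx β) A hA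
      exact ⟨_, hmem.1, fun α h₁ h₂ h₃ =>
        ⟨hmem.2.1, hmem.2.2, Function.argminOn_le (idx β) A ⟨h₁, h₂, h₃⟩⟩⟩
  choose pick hle hpick using h
  refine ⟨pick, hle, fun β α hα hαβ => ?_⟩
  have hfin : {a | a ∈ Iic β ∧ idx β a ∈ Iic (idx β α)}.Finite :=
    Finite.of_finite_image ((finite_Iic (idx β α)).subset (by rintro _ ⟨a, ha, rfl⟩; exact ha.2))
      ((hidx β).mono fun a ha => ha.1)
  have hfin' : {a | (a ∈ Iic β ∧ idx β a ∈ Iic (idx β α)) ∧ IsSuccLimit a ∧ a ≠ α}.Finite :=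
    hfin.subset (by rintro a ⟨h, -⟩; exact h)
  refine (hfin'.biUnion fun a ha => hC.finite_inter ha.2.1 hα ha.2.2).subset ?_
  rintro ξ ⟨hξ, hne⟩
  obtain ⟨h₁, h₂, h₃⟩ := hpick β ξ α hαβ hα hξ
  exact mem_biUnion (x := pick β ξ) ⟨⟨hle β ξ, h₃⟩, h₁, hne⟩ ⟨h₂, hξ⟩

theorem exists_embedding_prod : ∃ f : Omega1 × Omega1 → Omega1, Function.Injective f := by
  obtain ⟨e⟩ := Cardinal.eq.1 (Cardinal.mul_eq_self (Cardinal.aleph0_le_mk Omega1))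
  exact ⟨e, e.injective⟩

theorem exists_injective_prod_nat {α : Type*} (f : α → Omega1) (hf : Function.Injective f) :
    ∃ h : α × ℕ → Omega1, Function.Injective h := by
  obtain ⟨p, hp⟩ := exists_embedding_prod
  let n := Infinite.natEmbedding Omega1
  refine ⟨fun a => p (f a.1, n a.2), fun a b hab => ?_⟩
  have := hp hab
  rw [Prod.mk.injEq] at this
  exact Prod.ext (hf this.1) (n.injective this.2)

/-- Under `◇⁺` there are only `ℵ₁` many countable binary sequences. -/
theorem exists_injective_binSeq {W : Omega1 → Set (Set Omega1)} (hW : ∀ α, (W α).Countable)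
    (hdp : ∀ X : Set Omega1, ∃ D : Set Omega1, IsClub D ∧
        ∀ α ∈ D, X ∩ Iio α ∈ W α ∧ D ∩ Iio α ∈ W α) :
    ∃ f : BinSeq → Omega1, Function.Injective f := by
  have h : ∀ b : BinSeq, ∃ α, b.support ∈ W α := fun b => by
    obtain ⟨D, hD, hDW⟩ := hdp b.support
    obtain ⟨α, hα, hle⟩ := hD.isCofinal b.len
    refine ⟨α, ?_⟩
    have := (hDW α hα).1
    rwa [inter_eq_left.2 fun ξ hξ => hξ.1.trans_le hle] at this
  choose a ha using h
  have h' : ∀ α, ∃ f : Set Omega1 → ℕ, InjOn f (W α) := fun α =>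
    countable_iff_exists_injOn.1 (hW α)
  choose e he using h'
  obtain ⟨p, hp⟩ := exists_embedding_prod
  obtain ⟨q, hq⟩ := exists_injective_prod_nat p hp
  refine ⟨fun b => q ((b.len, a b), e (a b) b.support), fun b c hbc => ?_⟩
  have := hq hbc
  rw [Prod.mk.injEq, Prod.mk.injEq] at this
  obtain ⟨⟨h₁, h₂⟩, h₃⟩ := this
  refine BinSeq.eq_of_support_eq h₁ (he (a b) (ha b) (by rw [h₂]; exact ha c) ?_)
  rw [h₃, h₂]

/-- A single sequence guessing the sets of nodes with countable levels. -/
theorem exists_diamond {W : Omega1 → Set (Set Omega1)} (hW : ∀ α, (W α).Countable)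
    (hdp : ∀ X : Set Omega1, ∃ D : Set Omega1, IsClub D ∧
        ∀ α ∈ D, X ∩ Iio α ∈ W α ∧ D ∩ Iio α ∈ W α) :
    ∃ A : Omega1 → Set BinSeq, ∀ U : Set BinSeq, (∀ β, {u ∈ U | u.len ≤ β}.Countable) →
      ∀ D, IsClub D → ∃ δ ∈ D, A δ = {u ∈ U | u.len < δ} := by
  obtain ⟨c₀, hc₀⟩ := exists_injective_binSeq hW hdp
  obtain ⟨c, hc⟩ := exists_injective_prod_nat c₀ hc₀
  have h : ∀ δ, ∃ w : ℕ → Set Omega1, W δ ⊆ range w := fun δ =>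
    countable_iff_exists_subset_range.1 (hW δ)
  choose w hw using h
  -- Kunen's argument: suppose that for each `i` the `i`-th enumerated guesses, decoded in slot `i`,
  -- fail for some `U i`. Code all `U i` into one set; its trace on `δ` is enumerated at some place
  -- `j`, and slot `j` then guesses `U j` correctly.
  by_contra! hcon
  have hcon' : ∀ i : ℕ, ∃ U : Set BinSeq, (∀ β, {u ∈ U | u.len ≤ β}.Countable) ∧
      ∃ D, IsClub D ∧ ∀ δ ∈ D, {u | c (u, i) ∈ w δ i} ≠ {u ∈ U | u.len < δ} :=
    fun i => hcon fun δ => {u | c (u, i) ∈ w δ i}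
  choose U hU D hD hne using hcon'
  obtain ⟨D₀, hD₀, hX⟩ := hdp {x | ∃ i, ∃ u ∈ U i, c (u, i) = x}
  have hp : ∀ ξ : Omega1, ∃ η, ∀ i, ∀ u ∈ U i, u.len ≤ ξ → c (u, i) < η := fun ξ => by
    obtain ⟨η, hη⟩ := exists_gt_of_countable
      (countable_iUnion fun i => (hU i ξ).image fun u => c (u, i))
    exact ⟨η, fun i u hu hξ => hη _ (mem_iUnion.2 ⟨i, u, ⟨hu, hξ⟩, rfl⟩)⟩
  choose p hp using hp
  have hq : ∀ ξ : Omega1, ∃ η, ∀ i u, c (u, i) = ξ → u.len = η := fun ξ => by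
    by_cases h : ∃ v, c v = ξ
    · obtain ⟨v, rfl⟩ := h
      refine ⟨v.1.len, fun i u hu => ?_⟩
      rw [← hc hu]
    · exact ⟨ξ, fun i u hu => (h ⟨_, hu⟩).elim⟩
  choose q hq using hq
  -- Closure under `p` and `q` makes codes below `δ` correspond to nodes of length below `δ`.
  have hclub := ((hD₀.inter cof_omega1_ne (IsClub.iInter_of_countable cof_omega1_ne hD)).inter
    cof_omega1_ne (isClub_closed_fun p)).inter cof_omega1_ne (isClub_closed_fun q)
  obtain ⟨δ, ⟨⟨⟨hδ₀, hδD⟩, -, hδp⟩, -, hδq⟩, -⟩ := hclub.isCofinal (Classical.arbitrary Omega1)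
  obtain ⟨j, hj⟩ := hw δ (hX δ hδ₀).1
  refine hne j δ (mem_iInter.1 hδD j) ?_
  ext u
  rw [hj]
  constructor
  · rintro ⟨⟨i, u', hu', hu'c⟩, hlt⟩
    obtain ⟨rfl, rfl⟩ := Prod.mk.injEq .. ▸ hc hu'c
    exact ⟨hu', by rw [hq _ _ _ rfl]; exact hδq _ hlt⟩
  · rintro ⟨hu, hlt⟩
    exact ⟨⟨j, u, hu, rfl⟩, (hp u.len j u hu le_rfl).trans (hδp _ hlt)⟩

/-- Countable families guessing functions `ω₁ → ω` on a club, together with that club. -/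
theorem exists_guess {W : Omega1 → Set (Set Omega1)} (hW : ∀ α, (W α).Countable)
    (hdp : ∀ X : Set Omega1, ∃ D : Set Omega1, IsClub D ∧
        ∀ α ∈ D, X ∩ Iio α ∈ W α ∧ D ∩ Iio α ∈ W α) :
    ∃ G : Omega1 → Set ((Omega1 → ℕ) × Set Omega1), (∀ δ, (G δ).Countable) ∧
      ∀ g : Omega1 → ℕ, ∃ E : Set Omega1, IsClub E ∧ (∀ δ ∈ E, IsSuccLimit δ) ∧
        ∀ δ ∈ E, ∃ p ∈ G δ, (∀ ξ < δ, p.1 ξ = g ξ) ∧ ∀ ξ < δ, ξ ∈ p.2 ↔ ξ ∈ E := by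
  classical
  obtain ⟨c, hc⟩ := exists_injective_prod_nat (id : Omega1 → Omega1) Function.injective_id
  have hp : ∀ ξ : Omega1, ∃ η, ∀ n, c (ξ, n) < η := fun ξ => by
    obtain ⟨η, hη⟩ := exists_gt_of_countable (countable_range fun n => c (ξ, n))
    exact ⟨η, fun n => hη _ ⟨n, rfl⟩⟩
  choose p hp using hp
  let dec : Set Omega1 → Omega1 → ℕ := fun x ξ => if h : ∃ n, c (ξ, n) ∈ x then h.choose else 0
  -- At points of `K` the trace of the coded graph determines `g` below `δ`. As `K` does not depend
  -- on `g`, the trace of `D` determines that of `D ∩ K`.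
  let K : Set Omega1 := {a | IsSuccLimit a ∧ ∀ x < a, p x < a}
  refine ⟨fun δ => image2 (fun x d => (dec x, d ∩ K)) (W δ) (W δ),
    fun δ => (hW δ).image2 (hW δ) _, fun g => ?_⟩
  obtain ⟨D, hD, hDW⟩ := hdp {x | ∃ ξ, c (ξ, g ξ) = x}
  refine ⟨D ∩ K, hD.inter cof_omega1_ne (isClub_closed_fun p), fun δ hδ => hδ.2.1, fun δ hδ => ?_⟩
  refine ⟨_, ⟨_, (hDW δ hδ.1).1, _, (hDW δ hδ.1).2, rfl⟩, fun ξ hξ => ?_, fun ξ hξ => ?_⟩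
  · have h : ∃ n, c (ξ, n) ∈ {x | ∃ ξ, c (ξ, g ξ) = x} ∩ Iio δ :=
      ⟨g ξ, ⟨ξ, rfl⟩, (hp ξ _).trans (hδ.2.2 ξ hξ)⟩
    simp only [dec, dif_pos h]
    obtain ⟨⟨η, hη⟩, -⟩ := h.choose_spec
    have := hc hη
    rw [Prod.mk.injEq] at this
    rw [← this.2, this.1]
  · exact ⟨fun h => ⟨h.1.1, h.2⟩, fun h => ⟨⟨h.1, hξ⟩, h.2⟩⟩

theorem exists_context (hdp : DiamondPlus) {C : Omega1 → Set Omega1} (hC : IsLadderSystem C) :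
    ∃ Γ : Context C,
      (∀ X : Set Omega1, ∃ D, IsClub D ∧ ∀ δ ∈ D, X ∩ Iio δ ∈ Γ.killed δ) ∧
      (∀ g : Omega1 → ℕ, ∃ E : Set Omega1, IsClub E ∧ (∀ δ ∈ E, IsSuccLimit δ) ∧
        ∀ δ ∈ E, ∃ p ∈ Γ.guess δ, (∀ ξ < δ, p.1 ξ = g ξ) ∧ ∀ ξ < δ, ξ ∈ p.2 ↔ ξ ∈ E) ∧
      ∀ U : Set BinSeq, (∀ β, {u ∈ U | u.len ≤ β}.Countable) →
        ∀ D, IsClub D → ∃ δ ∈ D, Γ.diamond δ = {u ∈ U | u.len < δ} := by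
  obtain ⟨W, hW, hdp⟩ := hdp
  obtain ⟨G, hG, hG'⟩ := exists_guess hW hdp
  obtain ⟨A, hA⟩ := exists_diamond hW hdp
  obtain ⟨idx, hidx⟩ := exists_idx
  obtain ⟨pick, hle, hpick⟩ := hC.exists_pick
  refine ⟨{
    killed := W
    killed_countable := hW
    guess := G
    guess_countable := hG
    diamond := A
    idx := idx
    idx_injOn := fun β => (hidx β).mono fun _ h => (mem_Iio.1 h).le
    pick := pick
    pick_le := hle
    finite_pick_ne := hpick
    ladder_lt := fun α hα ξ hξ => (hC α hα).1 hξ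
    ladder_finite := fun α hα β hβ => hC.finite_le hα hβ }, fun X => ?_, hG', hA⟩
  obtain ⟨D, hD, hDW⟩ := hdp X
  exact ⟨D, hD, fun δ hδ => (hDW δ hδ).1⟩

/-! ### Trees of binary sequences -/

theorem eq_of_orderIso_Iio {a b : Omega1} (e : Iio a ≃o Iio b) : a = b := by
  have key : ∀ {a b : Omega1}, (Iio a ≃o Iio b) → ¬ a < b := by
    intro a b e h
    let f : Iio b → Iio b := fun x => ⟨(e.symm x).1, (mem_Iio.1 (e.symm x).2).trans h⟩
    have hf : StrictMono f := fun x y hxy => e.symm.lt_iff_lt.2 hxy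
    have h₁ : a ≤ (e.symm ⟨a, h⟩).1 := hf.le_apply (x := ⟨a, h⟩)
    exact h₁.not_gt (e.symm ⟨a, h⟩).2
  exact (not_lt.1 (key e.symm)).antisymm (not_lt.1 (key e))

section Embedding

variable {P : Type*} [PartialOrder P] {j : P → BinSeq}

/-- In a tree of binary sequences the predecessors of a node correspond to the ordinals below its
length. -/
theorem nonempty_orderIso_Iio (hj : ∀ x y, j x ≤ j y ↔ x ≤ y) (hl : IsLowerSet (range j)) (x : P) :
    Nonempty (Iio x ≃o Iio (j x).len) := by
  have hlt : ∀ {y z}, y < z ↔ j y < j z := fun {y z} => by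
    rw [lt_iff_le_not_ge, lt_iff_le_not_ge, hj, hj]
  let f : Iio x → Iio (j x).len := fun y => ⟨(j y).len, BinSeq.len_lt_of_lt (hlt.1 y.2)⟩
  have hle : ∀ y z : Iio x, f y ≤ f z ↔ y ≤ z := fun y z => by
    refine ⟨fun h => ?_, fun h => BinSeq.len_mono ((hj _ _).2 h)⟩
    exact (hj _ _).1 (BinSeq.le_of_len_le (hlt.1 y.2).le (hlt.1 z.2).le h)
  have hinj : Function.Injective f := fun y z h =>
    le_antisymm ((hle y z).1 h.le) ((hle z y).1 h.ge)
  have hsurj : Function.Surjective f := by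
    rintro ⟨ξ, hξ⟩
    have hlen := BinSeq.len_res (b := j x) (mem_Iio.1 hξ).le
    obtain ⟨y, hy⟩ := hl ((j x).res_le ξ) ⟨x, rfl⟩
    refine ⟨⟨y, hlt.2 (lt_of_le_of_ne (hy ▸ (j x).res_le ξ) fun h => ?_)⟩, ?_⟩
    · rw [← hy, h] at hlen
      exact (mem_Iio.1 hξ).ne' hlen
    · exact Subtype.ext (by simp only [f, hy, hlen])
  exact ⟨⟨Equiv.ofBijective f ⟨hinj, hsurj⟩, hle _ _⟩⟩

/-- Applies to the tree and to the subtree as an order of its own, so heights agree in both. -/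
theorem hasHeight_iff (hj : ∀ x y, j x ≤ j y ↔ x ≤ y) (hl : IsLowerSet (range j)) {x : P}
    {α : Omega1} : HasHeight x α ↔ (j x).len = α := by
  obtain ⟨e⟩ := nonempty_orderIso_Iio hj hl x
  constructor
  · rintro ⟨e'⟩
    exact eq_of_orderIso_Iio (e.symm.trans e')
  · rintro rfl
    exact ⟨e⟩

theorem isAronszajnTree_of_embedding (hj : ∀ x y, j x ≤ j y ↔ x ≤ y) (hl : IsLowerSet (range j))
    (hne : ∀ α, ∃ x, (j x).len = α) (hct : ∀ α, {b ∈ range j | b.len = α}.Countable)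
    (hch : ∀ B ⊆ range j, IsChain (· ≤ ·) B → B.Countable) : IsAronszajnTree P := by
  have hinj : Function.Injective j := fun x y h => le_antisymm ((hj x y).1 h.le) ((hj y x).1 h.ge)
  refine ⟨⟨fun x => ?_, fun x => ⟨_, (hasHeight_iff hj hl).2 rfl⟩, fun α => ?_, fun α => ?_⟩,
    fun A hA => ?_⟩
  · obtain ⟨e⟩ := nonempty_orderIso_Iio hj hl x
    exact e.toRelIsoLT.toRelEmbedding.isWellOrder
  · obtain ⟨x, hx⟩ := hne α
    exact ⟨x, (hasHeight_iff hj hl).2 hx⟩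
  · refine ((hct α).preimage hinj).mono fun x hx => ?_
    exact ⟨⟨x, rfl⟩, (hasHeight_iff hj hl).1 hx⟩
  · refine countable_of_injective_of_countable_image hinj.injOn
      (hch (j '' A) (image_subset_range j A) ?_)
    rintro _ ⟨x, hx, rfl⟩ _ ⟨y, hy, rfl⟩ hxy
    simp only [hj]
    exact hA hx hy fun h => hxy (h ▸ rfl)

end Embedding

/-! ### Countability of chains -/

variable {C : Omega1 → Set Omega1} {Γ : Context C} {R : BinSeq → Option Tag}

/-- The union of an uncountable chain is the characteristic function of a subset of `ω₁`, whose
trace on some limit `δ` is killed, although it belongs to a node of the tree. -/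
theorem countable_of_isChain (hR : ∀ δ, IsSuccLimit δ → Γ.Step R δ)
    (hΓ : ∀ X : Set Omega1, ∃ D, IsClub D ∧ ∀ δ ∈ D, X ∩ Iio δ ∈ Γ.killed δ)
    {B : Set BinSeq} (hB : B ⊆ tree R) (hch : IsChain (· ≤ ·) B) : B.Countable := by
  by_contra hunc
  have hlong : ∀ ξ, ∃ b ∈ B, ξ < b.len := by
    intro ξ
    by_contra! h
    refine hunc (MapsTo.countable_of_injOn (f := BinSeq.len) (t := Iic ξ) (fun b hb => h b hb) ?_
      (countable_Iic_omega1 ξ))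
    intro a ha b hb hab
    rcases hch.total ha hb with h' | h'
    · exact BinSeq.eq_of_le_of_len_le h' hab.ge
    · exact (BinSeq.eq_of_le_of_len_le h' hab.le).symm
  choose b hbB hb using hlong
  obtain ⟨D, hD, hDW⟩ := hΓ {ξ | (b ξ).ext ξ = true}
  obtain ⟨δ, ⟨hδD, hδ, -⟩, -⟩ := (hD.inter cof_omega1_ne (isClub_closed_fun id)).isCofinal
    (Classical.arbitrary Omega1)
  have hlen : ((b δ).res δ).len = δ := BinSeq.len_res (hb δ).le
  refine (hR δ hδ).support_notMem _ hlen (hB (hbB δ) δ (hb δ).le hδ) ?_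
  convert hDW δ hδD using 1
  ext ξ
  have key : ξ < δ → ((b δ).res δ).ext ξ = (b ξ).ext ξ := fun hξ => by
    rw [(BinSeq.le_iff.1 ((b δ).res_le δ)).2 ξ (hlen.symm ▸ hξ)]
    rcases hch.total (hbB δ) (hbB ξ) with h | h
    · exact (BinSeq.le_iff.1 h).2 ξ (hξ.trans (hb δ))
    · exact ((BinSeq.le_iff.1 h).2 ξ (hb ξ)).symm
  constructor
  · rintro ⟨h₁, h₂⟩
    rw [hlen] at h₁
    exact ⟨(key h₁).symm.trans h₂, h₁⟩
  · rintro ⟨h₁, h₂⟩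
    exact ⟨hlen.symm ▸ h₂, (key h₂).trans h₁⟩

/-! ### The subtree of a colouring: height, uniformization, antichains -/

section Subtree

variable {g : Omega1 → ℕ} {E : Set Omega1}

theorem valid_of_isClub (hE : IsClub E) (hlim : ∀ δ ∈ E, IsSuccLimit δ)
    (hguess : ∀ δ ∈ E, ∃ p ∈ Γ.guess δ, (∀ ξ < δ, p.1 ξ = g ξ) ∧ ∀ ξ < δ, ξ ∈ p.2 ↔ ξ ∈ E)
    (δ : Omega1) : Γ.Valid g E δ := by
  have hcl : ∀ ε, Acc E ε → ε ∈ E := by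
    rintro ε ⟨hε, hcof⟩
    refine hE.isLUB_mem (t := E ∩ Iio ε) inter_subset_left ?_ ⟨fun x hx => hx.2.le, fun y hy => ?_⟩
    · obtain ⟨x, hx⟩ := hε.nonempty_Iio
      obtain ⟨y, hy, -, hyε⟩ := hcof x hx
      exact ⟨y, hy, hyε⟩
    · by_contra! h
      obtain ⟨x, hx, hyx, hxε⟩ := hcof y h
      exact (hy ⟨hx, hxε⟩).not_gt hyx
  exact ⟨hlim, fun ε _ => hcl ε, fun ε _ hε => hguess ε (hcl ε hε)⟩

theorem exists_mem_gt_of_isClub {E : Set Omega1} (hE : IsClub E) (a : Omega1) : ∃ e ∈ E, a < e := by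
  obtain ⟨e, he, h⟩ := hE.isCofinal (succ a)
  exact ⟨e, he, lt_of_lt_of_le (lt_succ a) h⟩

theorem exists_long_extension (hR : ∀ δ, IsSuccLimit δ → Γ.Step R δ) (hE : IsClub E)
    (hV : ∀ δ, Γ.Valid g E δ) {s : BinSeq} (hs : s ∈ subtree R g E) (α : Omega1) :
    ∃ t ∈ subtree R g E, s ≤ t ∧ α ≤ t.len := by
  obtain ⟨e, he, hlt⟩ := exists_mem_gt_of_isClub hE (max s.len α)
  obtain ⟨b, hb, hlen, hsb, -⟩ := exists_extension e (fun ε _ => hR ε) (hV e) he hs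
    ((le_max_left _ _).trans_lt hlt) finite_empty 0 (0, 0)
  exact ⟨b, hb, hsb, hlen ▸ ((le_max_right _ _).trans_lt hlt).le⟩

theorem exists_len_eq (hR : ∀ δ, IsSuccLimit δ → Γ.Step R δ) (hE : IsClub E)
    (hV : ∀ δ, Γ.Valid g E δ) (α : Omega1) : ∃ t ∈ subtree R g E, t.len = α := by
  obtain ⟨b, hb⟩ := BinSeq.exists_empty
  obtain ⟨t, ht, -, hα⟩ := exists_long_extension hR hE hV (empty_mem_subtree R g E hb) α
  exact ⟨t.res α, subtree_isLowerSet R g E (t.res_le α) ht, BinSeq.len_res hα⟩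

/-- Accumulation points of `E` are treated when their level is built. Any other limit has its ladder
eventually inside one gap of `E`, where all but finitely many points get the default colour and are
assigned to this ladder. -/
theorem finite_colour_ne (hR : ∀ δ, IsSuccLimit δ → Γ.Step R δ) (hE : IsClub E) {s : BinSeq}
    (hs : s ∈ subtree R g E) (hlim : IsSuccLimit s.len) :
    {ξ ∈ C s.len | Γ.colour R g E (s.res ξ) ≠ g s.len}.Finite := by
  by_cases hacc : Acc E s.len
  · exact (hR _ hlim).colour_eq g E s hs rfl hacc
  have hgap : ∃ γ < s.len, ∀ x ∈ E, γ < x → s.len ≤ x := by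
    by_contra! h
    exact hacc ⟨hlim, fun β hβ => h β hβ⟩
  obtain ⟨γ, hγ, hgap⟩ := hgap
  obtain ⟨e, he, hγe⟩ := exists_mem_gt_of_isClub hE γ
  -- Equality is possible: the end of a gap belongs to the ladders made disjoint there.
  have hβ : s.len ≤ next E γ := hgap _ (next_mem ⟨e, he, hγe⟩) (lt_next ⟨e, he, hγe⟩)
  have hidx : {ξ | ξ < next E γ ∧ Γ.idx (next E γ) ξ ≤ (label R (s.res (floor E γ))).1}.Finite :=
    Finite.of_finite_image ((finite_Iic (label R (s.res (floor E γ))).1).subset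
      (by rintro _ ⟨a, ha, rfl⟩; exact ha.2)) ((Γ.idx_injOn _).mono fun a ha => ha.1)
  refine (((Γ.ladder_finite _ hlim γ hγ).union (Γ.finite_pick_ne _ _ hlim hβ)).union hidx).subset ?_
  rintro ξ ⟨hξ, hne⟩
  have hξs := Γ.ladder_lt _ hlim ξ hξ
  by_contra hnot
  rw [mem_union, mem_union, not_or, not_or] at hnot
  obtain ⟨⟨h₁, h₂⟩, h₃⟩ := hnot
  have hγξ : γ < ξ := lt_of_not_ge fun h => h₁ ⟨hξ, h⟩
  have hf : floor E ξ = floor E γ := floor_congr fun x =>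
    and_congr_right fun hx => ⟨fun h => le_of_not_gt fun h' => ((hgap x hx h').trans h).not_gt hξs,
      fun h => h.trans hγξ.le⟩
  have hn : next E ξ = next E γ := next_eq (next_mem ⟨e, he, hγe⟩) (hξs.trans_le hβ)
    fun x hx h => next_le hx (hγξ.trans h)
  have hp : Γ.pick (next E γ) ξ = s.len := by
    by_contra h
    exact h₂ ⟨hξ, h⟩
  rw [Γ.colour_res R g E hξs.le, hf, hn, if_neg fun h => h₃ ⟨hξs.trans_le hβ, h⟩, hp] at hne
  exact hne rfl

theorem countable_of_isAntichain (hR : ∀ δ, IsSuccLimit δ → Γ.Step R δ)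
    (hΓ : ∀ U : Set BinSeq, (∀ β, {u ∈ U | u.len ≤ β}.Countable) →
      ∀ D, IsClub D → ∃ δ ∈ D, Γ.diamond δ = {u ∈ U | u.len < δ})
    (hE : IsClub E) {A : Set BinSeq} (hA : A ⊆ subtree R g E) (hanti : IsAntichain (· ≤ ·) A) :
    A.Countable := by
  by_contra hunc
  have hlev : ∀ β, {u ∈ subtree R g E | u.len ≤ β}.Countable := fun β => by
    refine (countable_below (Γ := Γ) (R := R) (δ := succ β) fun ε _ => hR ε).mono ?_
    rintro u ⟨hu, hβ⟩
    exact ⟨hu.1, lt_succ_iff.2 hβ⟩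
  -- The nodes that decide `A`: above a member of `A`, or below none. A long member of `A` restricts
  -- to level `δ` and so passes through a short node of `U`, which is impossible in either case.
  let U : Set BinSeq := {s | s ∈ subtree R g E ∧ ((∃ a ∈ A, a ≤ s) ∨ ∀ a ∈ A, ¬ s ≤ a)}
  have hdense : ∀ s ∈ subtree R g E, ∃ u ∈ U, s ≤ u := fun s hs => by
    by_cases h : ∃ a ∈ A, s ≤ a
    · obtain ⟨a, ha, hsa⟩ := h
      exact ⟨a, ⟨hA ha, Or.inl ⟨a, ha, le_rfl⟩⟩, hsa⟩
    · exact ⟨s, ⟨hs, Or.inr fun a ha h' => h ⟨a, ha, h'⟩⟩, le_rfl⟩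
  choose! d hdU hd using hdense
  have hp : ∀ ξ : Omega1, ∃ η, ∀ s ∈ subtree R g E, s.len ≤ ξ → (d s).len < η := fun ξ => by
    obtain ⟨η, hη⟩ := exists_gt_of_countable ((hlev ξ).image fun s => (d s).len)
    exact ⟨η, fun s hs hξ => hη _ ⟨s, ⟨hs, hξ⟩, rfl⟩⟩
  choose p hp using hp
  obtain ⟨δ, ⟨⟨hδ, hδp⟩, -, hδn⟩, hdia⟩ := hΓ U
    (fun β => (hlev β).mono (by rintro u ⟨hu, hβ⟩; exact ⟨hu.1, hβ⟩)) _
    -- Closure under `p` keeps the dense set dense below `δ`; closure under `next E` makes `δ` an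
    -- accumulation point of `E`.
    ((isClub_closed_fun p).inter cof_omega1_ne (isClub_closed_fun (next E)))
  have hacc : Acc E δ := ⟨hδ, fun β hβ =>
    ⟨_, next_mem (exists_mem_gt_of_isClub hE β), lt_next (exists_mem_gt_of_isClub hE β), hδn β hβ⟩⟩
  have hbelow : Γ.IsDenseBelow R g E δ := fun s hs hsδ => by
    have hlt : (d s).len < δ := (hp s.len s hs le_rfl).trans (hδp _ hsδ)
    exact ⟨d s, hdia ▸ ⟨hdU s hs, hlt⟩, (hdU s hs).1, hlt, hd s hs⟩
  obtain ⟨a, ha, haδ⟩ : ∃ a ∈ A, δ < a.len := by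
    by_contra! h
    refine hunc ((hlev δ).mono ?_)
    exact fun a ha => ⟨hA ha, h a ha⟩
  obtain ⟨u, hu, hub⟩ := (hR δ hδ).sealed g E (a.res δ)
    (subtree_isLowerSet R g E (a.res_le δ) (hA ha)) (BinSeq.len_res haδ.le) hacc hbelow
  rw [hdia] at hu
  obtain ⟨⟨-, hu⟩, huδ⟩ := hu
  have hua : u ≤ a := hub.trans (a.res_le δ)
  rcases hu with ⟨a', ha', hau⟩ | h
  · obtain rfl : a' = a := hanti.eq ha' ha (hau.trans hua)
    exact ((BinSeq.len_mono hau).trans_lt huδ).not_gt haδ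
  · exact h a ha hua

end Subtree

end TreeUnif

/-! ### The theorem -/

open TreeUnif in
theorem theorem6p2 (hdp : DiamondPlus) (C : Omega1 → Set Omega1) (hC : IsLadderSystem C) :
    ∃ T : Set BinSeq, IsLowerSet T ∧ IsAronszajnTree T ∧
      ∀ f : Colouring C, IsMonochromatic f →
        ∃ S : Set T, IsSubtree S ∧ IsSuslinTree S ∧
          ∃ φ : S → ℕ, Uniformizes φ f := by
  classical
  obtain ⟨Γ, hkill, hguess, hdia⟩ := exists_context hdp hC
  obtain ⟨R, hR⟩ := exists_labelling Γ
  have hlev : ∀ α, {b ∈ tree R | b.len = α}.Countable := fun α =>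
    countable_level (Γ := Γ) α fun ε _ => hR ε
  have hjT : ∀ x y : tree R, x.1 ≤ y.1 ↔ x ≤ y := fun _ _ => Iff.rfl
  have hlT : IsLowerSet (Set.range (Subtype.val : tree R → BinSeq)) := by
    rw [Subtype.range_coe]
    exact tree_isLowerSet R
  refine ⟨tree R, tree_isLowerSet R, isAronszajnTree_of_embedding hjT hlT (fun α => ?_) ?_ ?_,
    fun f hf => ?_⟩
  · obtain ⟨b, hb⟩ := BinSeq.exists_empty
    obtain ⟨t, ht, hlen, -⟩ := exists_tree_extension (Γ := Γ) (R := R) α (fun ε _ => hR ε)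
      (empty_mem_subtree R (fun _ => 0) ∅ hb).1 (by
        rcases le_total b.len α with h | h
        · exact h
        · exact hb h)
    exact ⟨⟨t, ht⟩, hlen⟩
  · rw [Subtype.range_coe]
    exact hlev
  · rw [Subtype.range_coe]
    exact fun B hB hch => countable_of_isChain hR hkill hB hch
  -- Constancy reduces the colouring to one number per limit, which is what the tags guess and a
  -- label can enforce.
  obtain ⟨g, hg⟩ : ∃ g : Omega1 → ℕ, ∀ α, Order.IsSuccLimit α → ∀ ξ, f α ξ = g α := by
    choose! g hg using hf
    exact ⟨g, hg⟩
  obtain ⟨E, hE, hElim, hEguess⟩ := hguess g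
  have hV := valid_of_isClub hE hElim hEguess
  let S : Set (tree R) := {t | t.1 ∈ subtree R g E}
  have hjS : ∀ x y : S, x.1.1 ≤ y.1.1 ↔ x ≤ y := fun _ _ => Iff.rfl
  have hrange : Set.range (fun x : S => x.1.1) = subtree R g E := by
    ext b
    exact ⟨by rintro ⟨x, rfl⟩; exact x.2, fun hb => ⟨⟨⟨b, hb.1⟩, hb⟩, rfl⟩⟩
  have hlS : IsLowerSet (Set.range (fun x : S => x.1.1)) := by
    rw [hrange]
    exact subtree_isLowerSet R g E
  have hAr : IsAronszajnTree S := by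
    refine isAronszajnTree_of_embedding hjS hlS (fun α => ?_) ?_ ?_
    · obtain ⟨t, ht, hlen⟩ := exists_len_eq hR hE hV α
      exact ⟨⟨⟨t, ht.1⟩, ht⟩, hlen⟩
    · rw [hrange]
      intro α
      refine (hlev α).mono ?_
      exact fun b hb => ⟨hb.1.1, hb.2⟩
    · rw [hrange]
      exact fun B hB hch => countable_of_isChain hR hkill (hB.trans (subtree_subset R g E)) hch
  refine ⟨S, ⟨?_, ?_, ?_⟩, ⟨hAr, fun A hA => ?_⟩, fun x => Γ.colour R g E x.1.1, ?_⟩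
  · obtain ⟨b, hb⟩ := BinSeq.exists_empty
    have := empty_mem_subtree R g E hb
    exact ⟨⟨b, this.1⟩, this⟩
  · exact fun t s hst ht => subtree_isLowerSet R g E hst ht
  · intro s hs α
    obtain ⟨t, ht, hst, hα⟩ := exists_long_extension hR hE hV hs α
    exact ⟨⟨t, ht.1⟩, ht, hst, t.len, hα, (hasHeight_iff hjT hlT).2 rfl⟩
  · have hinj : Function.Injective (fun x : S => x.1.1) := fun x y h =>
      Subtype.ext (Subtype.ext h)
    refine Set.countable_of_injective_of_countable_image hinj.injOn
      (countable_of_isAntichain hR hdia hE (g := g) ?_ ?_)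
    · exact (Set.image_subset_range _ A).trans hrange.le
    · rintro _ ⟨x, hx, rfl⟩ _ ⟨y, hy, rfl⟩ hxy
      exact hA hx hy fun h => hxy (h ▸ rfl)
  · intro s α hα hs
    obtain rfl : s.1.1.len = α := (hasHeight_iff hjT hlT).1 hs
    rw [Filter.eventually_cofinite]
    refine ((finite_colour_ne hR hE s.2 hα).preimage Subtype.val_injective.injOn).subset ?_
    intro ξ hξ
    refine ⟨ξ.2, fun hcol => hξ ?_⟩
    have hlt := Γ.ladder_lt _ hα _ ξ.2
    have hmem := subtree_isLowerSet R g E (s.1.1.res_le ξ.1) s.2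
    have hlen := BinSeq.len_res (b := s.1.1) hlt.le
    refine ⟨⟨⟨s.1.1.res ξ.1, hmem.1⟩, hmem⟩, lt_of_le_of_ne (s.1.1.res_le ξ.1) fun h => ?_,
      (hasHeight_iff hjT hlT).2 hlen, hcol.trans (hg _ hα ξ).symm⟩
    have h' : s.1.1.res ξ.1 = s.1.1 := congrArg (fun x : S => x.1.1) h
    rw [h'] at hlen
    exact hlt.ne' hlen
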